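/- **Setting.** Finitely many processes $\Pi$ run a deterministic message-passing algorithm in the style of Fischer–Lynch–Paterson. A process makes a step on the receipt of a message or spontaneously; each step is made to execute one transaction, may send messages, and may answer the client of that transaction. The system is asynchronous (events may be interleaved arbitrarily, with no bound on speeds and message delays) and failure-free. An infinite execution is *fair* if no process with spontaneous steps to make is neglected for ever and every message sent is eventually received; clients are never obliged to act. Each object $x$ has a set $\mathrm{replicas}(x)\subseteq\Pi$. There are infinitely many transaction identifiers. The client of a transaction $T_i$ submits requests one by one to a coordinator, which replicates the first object accessed by $T_i$: reads and writes (at least one; each object is read at most once, and written at most once and only after it was read), then a termination request. The system does not know these requests in advance. A read is answered with a version $x_j$ of the object ($x_0$ is the initial one), a write with an acknowledgement, a termination request with commit; any request may be answered with abort instead. So the completed operations are $r_i(x_j)$, $w_i(x_i)$, $c_i$, $a_i$. A refinement mapping $\mathfrak F$ sends each finite execution $\rho$ to a history $h=\mathfrak F(\rho)$: the set of operations completed in $\rho$ with a strict partial order $<_h$, in which an operation that completes before another one is requested precedes it, the operations of each transaction are totally ordered (with $c_i$ or $a_i$ last), $w_j(x_j)<_h r_i(x_j)$ for every read $r_i(x_j)$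 with $j\ne0$, and writes of the same object are totally ordered; write $x_j\ll_h x_k$ if $w_j(x_j)<_h w_k(x_k)$. The initial transaction $T_0$ is regarded as having written and committed all $x_0$ before everything else. Distinct transactions are concurrent if neither terminates before the first operation of the other, and write-conflict if they write (ask to write) a common object. * **GPR** (genuine partial replication): in every execution, for every terminated transaction $T_i$, only processes that replicate an object accessed by $T_i$ make steps to execute $T_i$. * **OFU** (obstruction-free updates): in every fair execution, every request of a transaction that writes is eventually answered, and the transaction is not aborted unless it write-conflicts with a concurrent transaction. * **WFQ** (wait-free queries): in every fair execution, every request of a transaction that does not write is eventually answered, and the transaction is not aborted, whatever the other transactions do (they may stay pending for ever). * **SI**: $h$ is in SI if a snapshot point $s_i$ can be added for each $T_i$, before all operations of $T_i$ (this extends $<_h$ to a strict partial order that is unchanged on the operations of $h$), such that (D1) for every $r_i(x_j)$ with $j\neq i$: $c_j\in h$ and $c_j<s_i$, and for all $w_k(x_k),c_k\in h$ with $k\ne j$: $c_k<c_j$ or $s_i<c_k$; (D2) for all distinct committed $T_i,T_j$ that write a common object: $c_i<s_j$ or $c_j<s_i$. * **Non-trivial SI** (positive-freshness acceptance): let $\rho$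 be an execution, $h=\mathfrak F(\rho)$, let $T_i$ be a non-terminated transaction whose next request is a read of $x$ (possibly its first request), and let $x_j$ be the latest version of $x$ committed before the first operation of $T_i$ in $h$. If $h.r_i(x_j)$ is in SI and $T_i$ write-conflicts with no concurrent transaction, then some extension $\rho'$ of $\rho$, without any client request besides this read, is such that in $\mathfrak F(\rho')$ transaction $T_i$ reads $x_j$ or a $\ll$-later version of $x$. * **MON** (monotonic snapshots): for distinct $T_i,T_j$ write $T_i\to T_j$ if there are $r_i(x_k),r_j(y_l)\in h$ such that $r_i(x_k)<_h c_l$, or $w_l(x_l)\in h$ and $c_k<_h c_l$. A history $h$ is in MON if the transitive closure of $\to$ is a strict partial order, i.e. $\to$ has no cycle. **Theorem.** Suppose that some two objects have non-empty disjoint replica sets. Then no asynchronous failure-free system, with any refinement mapping $\mathfrak F$, that satisfies GPR, OFU, WFQ and non-trivial SI implements MON; that is, every such system has a finite execution $\rho$ with $\mathfrak F(\rho)\notin\mathrm{MON}$. -/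

import Mathlib

namespace PartialReplication

universe u v w s t

/-! ### Operations and histories -/

/-- Operations of transactions. Versions of an object are elements of `Option Tid`:
`some j` is the version written by transaction `j`, and `none` is the initial version, which is
regarded as written and committed before everything else.
`read i x v` is the read of version `v` of `x` by transaction `i`; `write i x` is the write by
transaction `i` of version `some i` of `x`. -/
inductive Op (Obj : Type u) (Tid : Type v) : Type (max u v)
  | read (i : Tid) (x : Obj) (ver : Option Tid)
  | write (i : Tid) (x : Obj)
  | commit (i : Tid)
  | abort (i : Tid)

namespace Op

variable {Obj : Type u} {Tid : Type v}

/-- The transaction an operation belongs to. -/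
def txn : Op Obj Tid → Tid
  | read i _ _ => i
  | write i _ => i
  | commit i => i
  | abort i => i

/-- Commits and aborts. -/
def IsTerminal (o : Op Obj Tid) : Prop :=
  o = commit o.txn ∨ o = abort o.txn

end Op

/-- A set of operations with a relation `lt` (written `<_h`). An operation occurs at most once,
since a transaction reads and writes an object at most once. -/
structure History (Obj : Type u) (Tid : Type v) where
  ops : Set (Op Obj Tid)
  lt : Op Obj Tid → Op Obj Tid → Prop

namespace History

variable {Obj : Type u} {Tid : Type v} (h : History Obj Tid)

/-- The axioms of a (possibly incomplete) history: a strict partial order on operations, in which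
the operations of a transaction form a sequence that ends with its commit or abort if there is
one, an object is read at most once by a transaction and is written only after it was read, a
version is written before it is read, and the writes to an object are totally ordered. -/
structure IsHistory : Prop where
  mem_of_lt : ∀ a b, h.lt a b → a ∈ h.ops ∧ b ∈ h.ops
  irrefl : ∀ a, ¬ h.lt a a
  trans : ∀ a b c, h.lt a b → h.lt b c → h.lt a c
  program_order : ∀ a ∈ h.ops, ∀ b ∈ h.ops, a.txn = b.txn → a ≠ b → h.lt a b ∨ h.lt b a
  terminal_last : ∀ a ∈ h.ops, ∀ b ∈ h.ops, a.txn = b.txn → a.IsTerminal → ¬ h.lt a b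
  read_once : ∀ i x v v', .read i x v ∈ h.ops → .read i x v' ∈ h.ops → v = v'
  read_before_write : ∀ i x, .write i x ∈ h.ops → ∃ v, h.lt (.read i x v) (.write i x)
  reads_from : ∀ i x j, .read i x (some j) ∈ h.ops → h.lt (.write j x) (.read i x (some j))
  writes_ordered : ∀ i j x, .write i x ∈ h.ops → .write j x ∈ h.ops → i ≠ j →
    h.lt (.write i x) (.write j x) ∨ h.lt (.write j x) (.write i x)

/-- The version order on the versions of `x`. -/
def VersionLt (x : Obj) : Option Tid → Option Tid → Prop
  | none, some k => .write k x ∈ h.ops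
  | some j, some k => h.lt (.write j x) (.write k x)
  | _, none => False

/-- `c_k <_h c_l`, where the initial transaction `none` commits before all others. -/
def CommitLt : Option Tid → Option Tid → Prop
  | none, some l => .commit l ∈ h.ops
  | some k, some l => h.lt (.commit k) (.commit l)
  | _, none => False

/-- The history `h.o`: operation `o` is appended after all operations of `h`. -/
def snoc (o : Op Obj Tid) : History Obj Tid where
  ops := insert o h.ops
  lt a b := h.lt a b ∨ (a ∈ h.ops ∧ b = o)

/-- Transaction `i` terminates before the first operation of transaction `j`. -/
def TxnPrecedes (i j : Tid) : Prop :=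
  ∃ a ∈ h.ops, a.txn = i ∧ a.IsTerminal ∧ ∀ b ∈ h.ops, b.txn = j → h.lt a b

/-- Two distinct transactions that occur in `h` are concurrent if none of them terminates before
the first operation of the other. -/
def Concurrent (i j : Tid) : Prop :=
  i ≠ j ∧ (∃ a ∈ h.ops, a.txn = i) ∧ (∃ a ∈ h.ops, a.txn = j) ∧
    ¬ h.TxnPrecedes i j ∧ ¬ h.TxnPrecedes j i

/-- `ver` is a version of `x` that is committed before the first operation of `i` (if `i` has no
operation in `h`, a version of `x` that is committed in `h`). -/
def CommittedBefore (i : Tid) (x : Obj) (ver : Option Tid) : Prop :=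
  ∀ j, ver = some j → .write j x ∈ h.ops ∧ .commit j ∈ h.ops ∧
    ∀ a ∈ h.ops, a.txn = i → h.lt (.commit j) a

/-- `ver` is the latest version of `x` that is committed before the first operation of `i`. -/
def LatestBefore (i : Tid) (x : Obj) (ver : Option Tid) : Prop :=
  h.CommittedBefore i x ver ∧
    ∀ ver', h.CommittedBefore i x ver' → ver' = ver ∨ h.VersionLt x ver' ver

/-! ### Snapshot isolation -/

/-- `lt'` is the order of an extended history `h_s` obtained by adding to `h` a snapshot point
`Sum.inr i` for every transaction `i`, before all operations of `i`. -/
structure IsSnapshotExtension (lt' : Op Obj Tid ⊕ Tid → Op Obj Tid ⊕ Tid → Prop) : Prop where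
  irrefl : ∀ a, ¬ lt' a a
  trans : ∀ a b c, lt' a b → lt' b c → lt' a c
  extends_lt : ∀ a ∈ h.ops, ∀ b ∈ h.ops, (lt' (.inl a) (.inl b) ↔ h.lt a b)
  snapshot_first : ∀ a ∈ h.ops, lt' (.inr a.txn) (.inl a)

/-- Snapshot isolation (generalized): some choice of snapshot points satisfies the read rule D1
and the write rule D2. -/
def InSI : Prop :=
  ∃ lt' : Op Obj Tid ⊕ Tid → Op Obj Tid ⊕ Tid → Prop, h.IsSnapshotExtension lt' ∧
    -- D1.1 and D1.2
    (∀ i x j, .read i x (some j) ∈ h.ops → j ≠ i →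
      .commit j ∈ h.ops ∧ lt' (.inl (.commit j)) (.inr i)) ∧
    -- D1.3
    (∀ i x ver k, .read i x ver ∈ h.ops → ver ≠ some i →
      .write k x ∈ h.ops → .commit k ∈ h.ops → ver ≠ some k →
      (∃ j, ver = some j ∧ lt' (.inl (.commit k)) (.inl (.commit j))) ∨
        lt' (.inr i) (.inl (.commit k))) ∧
    -- D2
    (∀ i j x, i ≠ j → .commit i ∈ h.ops → .commit j ∈ h.ops →
      .write i x ∈ h.ops → .write j x ∈ h.ops →
      lt' (.inl (.commit i)) (.inr j) ∨ lt' (.inl (.commit j)) (.inr i))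

/-! ### Monotonic snapshots -/

/-- Snapshot precedence `T_i → T_j` between distinct transactions: there are reads `r_i(x_k)` and
`r_j(y_l)` in `h` such that either `r_i(x_k) <_h c_l`, or `w_l(x_l)` is in `h` and `c_k <_h c_l`.
(Nothing precedes the initial commit, so `l` is never the initial transaction.) -/
def SnapshotPrecedes (i j : Tid) : Prop :=
  i ≠ j ∧ ∃ x k y l, .read i x k ∈ h.ops ∧ .read j y (some l) ∈ h.ops ∧
    (h.lt (.read i x k) (.commit l) ∨ (.write l x ∈ h.ops ∧ h.CommitLt k (some l)))

/-- Monotonic snapshots: snapshot precedence generates a partial order, i.e. has no cycle. -/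
def MON : Prop :=
  ∀ i, ¬ Relation.TransGen h.SnapshotPrecedes i i

end History

/-! ### Clients -/

/-- Requests that the client of a transaction submits to the coordinator of the transaction. -/
inductive Request (Obj : Type u) : Type u
  | read (x : Obj)
  | write (x : Obj)
  | terminate

/-- Replies of the coordinator; `val ver` is the version returned by a read. -/
inductive Reply (Tid : Type v) : Type v
  | val (ver : Option Tid)
  | ack
  | commit
  | abort

/-- `Completes i q r o`: reply `r` to request `q` of transaction `i` completes operation `o`.
Any request may be answered by aborting the transaction. -/
inductive Completes {Obj : Type u} {Tid : Type v} (i : Tid) :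
    Request Obj → Reply Tid → Op Obj Tid → Prop
  | read (x : Obj) (ver : Option Tid) : Completes i (.read x) (.val ver) (.read i x ver)
  | write (x : Obj) : Completes i (.write x) .ack (.write i x)
  | commit : Completes i .terminate .commit (.commit i)
  | abort (q : Request Obj) : Completes i q .abort (.abort i)

/-- Items of the trace of an execution: `req p i q` is the submission of request `q` of
transaction `i` to its coordinator `p`; `step p i r` is a step that `p` makes to execute
transaction `i`, in which it possibly answers the outstanding request of `i`. -/
inductive Obs (Pr : Type w) (Obj : Type u) (Tid : Type v) : Type (max u v w)
  | req (p : Pr) (i : Tid) (q : Request Obj)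
  | step (p : Pr) (i : Tid) (r : Option (Reply Tid))

section Trace

variable {Pr : Type w} {Obj : Type u} {Tid : Type v}

/-- The request `q` of transaction `i`, submitted to `p`, is not answered yet. -/
def Outstanding (τ : List (Obs Pr Obj Tid)) (i : Tid) (p : Pr) (q : Request Obj) : Prop :=
  ∃ τ₁ τ₂, τ = τ₁ ++ .req p i q :: τ₂ ∧ ∀ p' r, .step p' i (some r) ∉ τ₂

/-- Transaction `i` is aborted in the trace. -/
def Aborted (τ : List (Obs Pr Obj Tid)) (i : Tid) : Prop :=
  ∃ p, .step p i (some .abort) ∈ τ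

/-- Transaction `i` is committed or aborted in the trace. -/
def Terminated (τ : List (Obs Pr Obj Tid)) (i : Tid) : Prop :=
  (∃ p, .step p i (some .commit) ∈ τ) ∨ Aborted τ i

/-- The objects accessed by transaction `i`. -/
def accessed (τ : List (Obs Pr Obj Tid)) (i : Tid) : Set Obj :=
  {x | ∃ p, .req p i (.read x) ∈ τ ∨ .req p i (.write x) ∈ τ}

/-- The objects that transaction `i` asked to write. -/
def writeSet (τ : List (Obs Pr Obj Tid)) (i : Tid) : Set Obj :=
  {x | ∃ p, .req p i (.write x) ∈ τ}

/-- Two transactions write-conflict if they write a common object. -/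
def WriteConflict (τ : List (Obs Pr Obj Tid)) (i j : Tid) : Prop :=
  (writeSet τ i ∩ writeSet τ j).Nonempty

/-- The client of transaction `i` may now submit request `q` to process `p`: the transaction is not
terminated, all its requests so far were submitted to `p` and are answered, an object is read or
written at most once and is written only after it was read, and a transaction accesses at least
one object. The coordinator replicates (`R`) the first object that the transaction accesses. -/
def Legal (R : Obj → Set Pr) (τ : List (Obs Pr Obj Tid)) (p : Pr) (i : Tid)
    (q : Request Obj) : Prop :=
  ¬ Terminated τ i ∧ (∀ p' q', ¬ Outstanding τ i p' q') ∧ (∀ p' q', .req p' i q' ∈ τ → p' = p) ∧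
    match q with
    | .read x => .req p i (.read x) ∉ τ ∧ ((∀ q', .req p i q' ∉ τ) → p ∈ R x)
    | .write x => .req p i (.read x) ∈ τ ∧ .req p i (.write x) ∉ τ
    | .terminate => ∃ q', .req p i q' ∈ τ

open Classical in
/-- What the client of `i` sees of a reply `r` emitted by process `p`: it is ignored unless it
answers a request of `i` that is outstanding at `p`. -/
noncomputable def visibleReply (τ : List (Obs Pr Obj Tid)) (p : Pr) (i : Tid)
    (r : Option (Reply Tid)) : Option (Reply Tid) :=
  r.filter fun r' => decide (∃ (q : Request Obj) (o : Op Obj Tid),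
    Outstanding τ i p q ∧ Completes i q r' o)

/-- Operation `o` is executed between positions `a` (its request) and `b` (its reply). -/
def Spans (τ : List (Obs Pr Obj Tid)) (o : Op Obj Tid) (a b : ℕ) : Prop :=
  a < b ∧ ∃ p p' i q r, τ[a]? = some (.req p i q) ∧ τ[b]? = some (.step p' i (some r)) ∧
    (∀ k, a < k → k < b → ∀ p'' r', τ[k]? ≠ some (.step p'' i (some r'))) ∧ Completes i q r o

end Trace

/-! ### Asynchronous message-passing systems -/

/-- What happens when a process makes a step: the transaction `txn` that the step executes, the new
local state, the messages sent (with their destinations) and a possible reply to the client of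
`txn`. -/
structure Outcome (Pr : Type w) (Tid : Type v) (State : Type s) (Msg : Type t) where
  txn : Tid
  state : State
  sends : Multiset (Pr × Msg)
  reply : Option (Reply Tid)

/-- A deterministic distributed algorithm in the style of Fischer, Lynch and Paterson: initial
local states, the effect of a client request on its coordinator, the step that a process makes on
the receipt of a message, and its next spontaneous step, if there is one. -/
structure System (Pr : Type w) (Obj : Type u) (Tid : Type v) where
  State : Type s
  Msg : Type t
  init : Pr → State
  accept : Pr → Tid → Request Obj → State → State
  receive : Pr → Msg → State → Outcome Pr Tid State Msg
  spontaneous : Pr → State → Option (Outcome Pr Tid State Msg)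

namespace System

variable {Pr : Type w} {Obj : Type u} {Tid : Type v} (S : System.{u, v, w, s, t} Pr Obj Tid)

/-- Events: a client request, the delivery of a message, a spontaneous step of a process. -/
inductive Event
  | request (p : Pr) (i : Tid) (q : Request Obj)
  | deliver (p : Pr) (m : S.Msg)
  | spontaneous (p : Pr)

/-- Local states, messages in transit (with their destinations), and the trace so far. -/
structure Config where
  state : Pr → S.State
  net : Multiset (Pr × S.Msg)
  trace : List (Obs Pr Obj Tid)

/-- The initial configuration. -/
def initial : S.Config := ⟨S.init, 0, []⟩

variable {S}

open Classical in
/-- Process `p` makes a step with the given outcome, `rest` being the messages left in transit. -/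
noncomputable def Config.apply (c : S.Config) (p : Pr) (rest : Multiset (Pr × S.Msg))
    (out : Outcome Pr Tid S.State S.Msg) : S.Config where
  state := Function.update c.state p out.state
  net := rest + out.sends
  trace := c.trace ++ [.step p out.txn (visibleReply c.trace p out.txn out.reply)]

open Classical in
/-- The coordinator `p` takes in a request. -/
noncomputable def Config.submit (c : S.Config) (p : Pr) (i : Tid) (q : Request Obj) :
    S.Config where
  state := Function.update c.state p (S.accept p i q (c.state p))
  net := c.net
  trace := c.trace ++ [.req p i q]

variable (S)

/-- One event of an execution. There is no bound on relative speeds or on message delays, messages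
may overtake each other, and no process crashes. -/
inductive Step (R : Obj → Set Pr) : S.Config → S.Event → S.Config → Prop
  | request (c : S.Config) (p : Pr) (i : Tid) (q : Request Obj) (hq : Legal R c.trace p i q) :
      Step R c (.request p i q) (c.submit p i q)
  | deliver (c : S.Config) (p : Pr) (m : S.Msg) (rest : Multiset (Pr × S.Msg))
      (hm : c.net = (p, m) ::ₘ rest) :
      Step R c (.deliver p m) (c.apply p rest (S.receive p m (c.state p)))
  | spontaneous (c : S.Config) (p : Pr) (out : Outcome Pr Tid S.State S.Msg)
      (ho : S.spontaneous p (c.state p) = some out) :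
      Step R c (.spontaneous p) (c.apply p c.net out)

/-- `Run R ρ c`: the finite sequence of events `ρ` is an execution, and it leads to `c`. -/
inductive Run (R : Obj → Set Pr) : List S.Event → S.Config → Prop
  | nil : Run R [] S.initial
  | snoc {ρ : List S.Event} {c c' : S.Config} {e : S.Event} (h : Run R ρ c)
      (hs : S.Step R c e c') : Run R (ρ ++ [e]) c'

/-- An infinite execution: a sequence of configurations, with possible pauses (`none`) between
events. -/
structure InfRun (R : Obj → Set Pr) where
  cfg : ℕ → S.Config
  ev : ℕ → Option S.Event
  start : cfg 0 = S.initial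
  pause : ∀ n, ev n = none → cfg (n + 1) = cfg n
  step : ∀ n e, ev n = some e → S.Step R (cfg n) e (cfg (n + 1))

variable {S} {R : Obj → Set Pr}

/-- The events before time `n`. -/
def InfRun.events (σ : S.InfRun R) (n : ℕ) : List S.Event :=
  (List.range n).filterMap σ.ev

/-- Every process makes spontaneous steps again and again as long as it has any to make, and every
message in transit is eventually received. Clients are not obliged to do anything. -/
def InfRun.Fair (σ : S.InfRun R) : Prop :=
  (∀ p n, ∃ m ≥ n, S.spontaneous p ((σ.cfg m).state p) = none ∨
    σ.ev m = some (.spontaneous p)) ∧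
  ∀ n p msg, (p, msg) ∈ (σ.cfg n).net → ∃ m ≥ n, σ.ev m = some (.deliver p msg)

/-- Every request of transaction `i` is eventually answered. -/
def InfRun.Answers (σ : S.InfRun R) (i : Tid) : Prop :=
  ∀ n p q, Outstanding (σ.cfg n).trace i p q → ∃ m ≥ n, ¬ Outstanding (σ.cfg m).trace i p q

/-- Transaction `i` asks to write some object in the course of `σ`. -/
def InfRun.Updates (σ : S.InfRun R) (i : Tid) : Prop :=
  ∃ n, (writeSet (σ.cfg n).trace i).Nonempty

variable (S) (R)

/-- `F` maps every execution to a history which consists of the operations completed in the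
execution, and in which an operation that completes before another one is requested precedes it.
Operations that overlap in time may be ordered or not. -/
def IsRefinementMapping (F : List S.Event → History Obj Tid) : Prop :=
  ∀ ρ c, S.Run R ρ c → (F ρ).IsHistory ∧ (∀ o, o ∈ (F ρ).ops ↔ ∃ a b, Spans c.trace o a b) ∧
    ∀ o o' a b a' b', Spans c.trace o a b → Spans c.trace o' a' b' → b < a' → (F ρ).lt o o'

/-- Genuine partial replication: for every (terminated) transaction of an execution, only processes
that replicate an object accessed by the transaction make steps to execute it. -/
def GPR : Prop :=
  ∀ ρ c, S.Run R ρ c → ∀ i, Terminated c.trace i →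
    ∀ p r, .step p i r ∈ c.trace → ∃ x ∈ accessed c.trace i, p ∈ R x

/-- Obstruction-free updates: the requests of an update transaction are eventually answered (so
that it terminates as soon as its client asks for it), and the transaction is not aborted, unless
it write-conflicts with some concurrent transaction. -/
def ObstructionFreeUpdates (F : List S.Event → History Obj Tid) : Prop :=
  ∀ σ : S.InfRun R, σ.Fair → ∀ i, σ.Updates i → σ.Answers i ∧
    ((∀ n j, (F (σ.events n)).Concurrent i j → ¬ WriteConflict (σ.cfg n).trace i j) →
      ∀ n, ¬ Aborted (σ.cfg n).trace i)

/-- Wait-free queries: the requests of a read-only transaction are eventually answered and the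
transaction is not aborted, whatever the other transactions do (they may stay pending for
ever). -/
def WaitFreeQueries : Prop :=
  ∀ σ : S.InfRun R, σ.Fair → ∀ i, ¬ σ.Updates i → σ.Answers i ∧
    ∀ n, ¬ Aborted (σ.cfg n).trace i

/-- Non-triviality with respect to snapshot isolation (positive-freshness acceptance). Let `i` be a
transaction that is about to read `x` after an execution with history `h`, and let `ver` be the
latest version of `x` committed before the first operation of `i`. If `h.r_i(x_ver)` is in `SI` and
`i` does not write-conflict with a concurrent transaction, then the execution has an extension,
without any other client request, in which `i` reads at least version `ver` of `x`. -/
def NonTrivialSI (F : List S.Event → History Obj Tid) : Prop :=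
  ∀ ρ c, S.Run R ρ c → ∀ i p x ver, Legal R c.trace p i (.read x) →
    (F ρ).LatestBefore i x ver → ((F ρ).snoc (.read i x ver)).InSI →
    (∀ j, (F ρ).Concurrent i j → ¬ WriteConflict c.trace i j) →
    ∃ (υ : List S.Event) (c' : S.Config), (∀ p' i' q', .request p' i' q' ∉ υ) ∧
      S.Run R (ρ ++ .request p i (.read x) :: υ) c' ∧
      ∃ ver', .read i x ver' ∈ (F (ρ ++ .request p i (.read x) :: υ)).ops ∧
        (ver' = ver ∨ (F (ρ ++ .request p i (.read x) :: υ)).VersionLt x ver ver')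

/-- Every history that the system produces satisfies the criterion `C`. -/
def Implements (F : List S.Event → History Obj Tid) (C : History Obj Tid → Prop) : Prop :=
  ∀ ρ c, S.Run R ρ c → C (F ρ)

end System

end PartialReplication

open PartialReplication

/-! Two independent executions commute, and the moment at which a query starts reading one object
need not be known at the replicas of another. Let `x` and `y` have disjoint replica sets. At the
replicas of `x`, a query `a` reads `x` and pauses, an update `k` of `x` commits, and a query `b`
reads `x_k`; call this `ρ₂`. At the replicas of `y`, an update `l` of `y` commits; call this `ρ₁`.
They share neither processes nor transactions, so `ρ₁ρ₂` and `ρ₂ρ₁` are both executions and end with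
the same states, the same messages in transit and the same items of every transaction. After `ρ₁ρ₂`,
version `y_l` was committed before `a` began. Placing every snapshot just before the first operation
of its transaction shows that a read of `y_l` by `a` stays in SI, so non-triviality yields a
continuation `υ` in which `a` reads `y_l`. The same `υ` is possible after `ρ₂ρ₁`, with the same
result. But there `r_a(x)` precedes `c_k` while `b` reads `x_k`, and `r_b(x_k)` precedes `c_l` while
`a` reads `y_l`: thus `a → b → a`. Two points need work. Genuine partial replication only speaks of
terminated transactions, whereas `a` and `b` are still running; liveness allows them to be
terminated without further accesses, which confines all steps to replicas of objects already
accessed (`Run.step_mem_replicas`). Liveness in turn concerns infinite fair executions, so every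
finite execution is extended to a fair one by a queue scheduler (`Run.exists_fair`). The commutation
is `Run.append_run` with `Run.transfer`; SI acceptance is `inSI_of_first_operation`, used through
`Run.exists_fresh_read`; all order facts come from `IsRefinementMapping.lt_of_completed`. -/

namespace PartialReplication

universe u v w s t

/-! ### Traces: outstanding requests, completed operations, well-formedness -/

section Trace

variable {Pr : Type w} {Obj : Type u} {Tid : Type v}

/-- The transaction of an item of a trace. -/
def Obs.txn : Obs Pr Obj Tid → Tid
  | req _ i _ => i
  | step _ i _ => i

/-- The process of an item of a trace. -/
def Obs.proc : Obs Pr Obj Tid → Pr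
  | req p _ _ => p
  | step p _ _ => p

/-- Operation `o` is completed in the trace. -/
def Completed (τ : List (Obs Pr Obj Tid)) (o : Op Obj Tid) : Prop :=
  ∃ τ₁ τ₂ p p' i q r, τ = τ₁ ++ .step p' i (some r) :: τ₂ ∧ Outstanding τ₁ i p q ∧
    Completes i q r o

/-- Requests obey `Legal`, and replies answer outstanding requests. -/
structure WellFormed (R : Obj → Set Pr) (τ : List (Obs Pr Obj Tid)) : Prop where
  legal : ∀ τ₁ τ₂ p i q, τ = τ₁ ++ .req p i q :: τ₂ → Legal R τ₁ p i q
  reply : ∀ τ₁ τ₂ p i r, τ = τ₁ ++ .step p i (some r) :: τ₂ →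
    ∃ q o, Outstanding τ₁ i p q ∧ Completes i q r o

lemma concat_eq_append_cons {α : Type*} {l l₁ l₂ : List α} {a b : α}
    (h : l ++ [a] = l₁ ++ b :: l₂) :
    (l = l₁ ∧ a = b ∧ l₂ = []) ∨ ∃ l₃, l = l₁ ++ b :: l₃ ∧ l₂ = l₃ ++ [a] := by
  rcases List.eq_nil_or_concat l₂ with rfl | ⟨l₃, c, rfl⟩
  · obtain ⟨h₁, h₂⟩ := List.append_inj' h rfl
    simp_all
  · right
    have h' : l ++ [a] = (l₁ ++ b :: l₃) ++ [c] := by simpa using h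
    obtain ⟨h₁, h₂⟩ := List.append_inj' h' rfl
    exact ⟨l₃, h₁, by simp_all⟩

lemma exists_first_split {α : Type*} (P : α → Prop) {l : List α} (h : ∃ a ∈ l, P a) :
    ∃ l₁ a l₂, l = l₁ ++ a :: l₂ ∧ P a ∧ ∀ b ∈ l₁, ¬ P b := by
  induction l with
  | nil => simp at h
  | cons c l ih =>
    by_cases hc : P c
    · exact ⟨[], c, l, rfl, hc, by simp⟩
    · obtain ⟨a, ha, hP⟩ := h
      have ha' : a ∈ l := by
        rcases List.mem_cons.1 ha with rfl | h'
        · exact absurd hP hc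
        · exact h'
      obtain ⟨l₁, b, l₂, rfl, hb, hl⟩ := ih ⟨a, ha', hP⟩
      refine ⟨c :: l₁, b, l₂, rfl, hb, ?_⟩
      intro d hd
      rcases List.mem_cons.1 hd with rfl | h'
      · exact hc
      · exact hl _ h'

variable {τ τ' : List (Obs Pr Obj Tid)} {i : Tid} {p p' : Pr} {q q' : Request Obj}
  {o o' : Op Obj Tid} {R : Obj → Set Pr}

lemma Completes.txn_eq {r : Reply Tid} (h : Completes i q r o) : o.txn = i := by
  cases h <;> rfl

lemma Outstanding.mem (h : Outstanding τ i p q) : .req p i q ∈ τ := by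
  obtain ⟨τ₁, τ₂, rfl, -⟩ := h
  simp

lemma Outstanding.append (h : Outstanding τ i p q) (h' : ∀ p' r, .step p' i (some r) ∉ τ') :
    Outstanding (τ ++ τ') i p q := by
  obtain ⟨τ₁, τ₂, rfl, hr⟩ := h
  refine ⟨τ₁, τ₂ ++ τ', by simp, fun p' r hm => ?_⟩
  rcases List.mem_append.1 hm with hm | hm
  · exact hr _ _ hm
  · exact h' _ _ hm

lemma outstanding_concat_req : Outstanding (τ ++ [.req p i q]) i p q :=
  ⟨τ, [], rfl, by simp⟩

lemma Outstanding.of_append (h : Outstanding (τ ++ τ') i p q) (h' : .req p i q ∉ τ') :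
    Outstanding τ i p q := by
  obtain ⟨τ₁, τ₂, he, hr⟩ := h
  rcases List.append_eq_append_iff.1 he with ⟨l, rfl, rfl⟩ | ⟨l, rfl, hl⟩
  · simp at h'
  · rcases l with _ | ⟨a, l⟩
    · simp only [List.nil_append] at hl
      subst hl
      simp at h'
    · simp only [List.cons_append, List.cons.injEq] at hl
      obtain ⟨rfl, rfl⟩ := hl
      exact ⟨τ₁, l, rfl, fun p' r hm => hr p' r (by simp [hm])⟩

lemma Completed.append (h : Completed τ o) : Completed (τ ++ τ') o := by
  obtain ⟨τ₁, τ₂, p, p', i, q, r, rfl, h₁, h₂⟩ := h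
  exact ⟨τ₁, τ₂ ++ τ', p, p', i, q, r, by simp, h₁, h₂⟩

lemma Completed.exists_req (h : Completed τ o) :
    ∃ p q r, .req p o.txn q ∈ τ ∧ Completes o.txn q r o := by
  obtain ⟨τ₁, τ₂, p, p', i, q, r, rfl, h₁, h₂⟩ := h
  have := h₂.txn_eq
  subst this
  exact ⟨p, q, r, by simp [h₁.mem], h₂⟩

lemma Completed.req_read {x : Obj} {ver : Option Tid} (h : Completed τ (.read i x ver)) :
    ∃ p, .req p i (.read x) ∈ τ := by
  obtain ⟨p, q, r, h, hc⟩ := h.exists_req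
  cases hc
  exact ⟨p, h⟩

lemma Completed.req_write {x : Obj} (h : Completed τ (.write i x)) :
    ∃ p, .req p i (.write x) ∈ τ := by
  obtain ⟨p, q, r, h, hc⟩ := h.exists_req
  cases hc
  exact ⟨p, h⟩

lemma Spans.completed {a b : ℕ} (h : Spans τ o a b) : Completed τ o := by
  obtain ⟨hab, p, p', i, q, r, ha, hb, hk, hc⟩ := h
  obtain ⟨hb', hb⟩ := List.getElem?_eq_some_iff.1 hb
  obtain ⟨ha', ha⟩ := List.getElem?_eq_some_iff.1 ha
  refine ⟨τ.take b, τ.drop (b + 1), p, p', i, q, r, ?_, ⟨(τ.take b).take a,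
    (τ.take b).drop (a + 1), ?_, ?_⟩, hc⟩
  · rw [← hb, List.getElem_cons_drop, List.take_append_drop]
  · have ha'' : a < (τ.take b).length := by simp; omega
    have : (τ.take b)[a] = .req p i q := by simp [ha]
    rw [← this, List.getElem_cons_drop, List.take_append_drop]
  · intro p'' r' hm
    obtain ⟨n, hn, he⟩ := List.mem_iff_getElem.1 hm
    simp only [List.length_drop, List.length_take] at hn
    simp only [List.getElem_drop, List.getElem_take] at he
    refine hk (a + 1 + n) (by omega) (by omega) p'' r' ?_
    rw [List.getElem?_eq_some_iff]
    exact ⟨by omega, he⟩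

/-- The bound `b < τ.length` is what later places operations of a prefix before those requested
after it. -/
lemma Completed.exists_spans (h : Completed τ o) (τ' : List (Obs Pr Obj Tid)) :
    ∃ a b, Spans (τ ++ τ') o a b ∧ b < τ.length := by
  obtain ⟨τ₁, τ₂, p, p', i, q, r, rfl, ⟨l₁, l₂, rfl, hl⟩, hc⟩ := h
  refine ⟨l₁.length, (l₁ ++ .req p i q :: l₂).length, ⟨by simp, p, p', i, q, r, ?_, ?_, ?_, hc⟩,
    by simp⟩
  · simp
  · rw [List.append_assoc (l₁ ++ _), List.getElem?_append_right le_rfl]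
    simp
  · intro k hk hk' p'' r' he
    apply hl p'' r'
    rw [List.append_assoc (l₁ ++ _), List.getElem?_append_left hk',
      List.getElem?_append_right hk.le] at he
    obtain ⟨n, rfl⟩ : ∃ n, k = l₁.length + 1 + n := ⟨k - l₁.length - 1, by omega⟩
    have : l₁.length + 1 + n - l₁.length = n + 1 := by omega
    rw [this, List.getElem?_cons_succ] at he
    exact List.mem_of_getElem? he

/-- Positions are needed only for the real-time order. Membership in a history is handled by
splitting the trace, which behaves well under concatenation and projection. -/
lemma exists_spans_iff : (∃ a b, Spans τ o a b) ↔ Completed τ o := by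
  constructor
  · rintro ⟨a, b, h⟩
    exact h.completed
  · intro h
    obtain ⟨a, b, h, -⟩ := h.exists_spans []
    exact ⟨a, b, by simpa using h⟩

lemma Spans.le_of_forall_mem {a b : ℕ} (h : Spans (τ ++ τ') o a b) (hτ : ∀ m ∈ τ, m.txn ≠ o.txn) :
    τ.length ≤ a := by
  obtain ⟨hab, p, p', i, q, r, ha, hb, hk, hc⟩ := h
  by_contra! hlt
  rw [List.getElem?_append_left hlt] at ha
  exact hτ _ (List.mem_of_getElem? ha) hc.txn_eq.symm

namespace WellFormed

lemma nil : WellFormed R ([] : List (Obs Pr Obj Tid)) :=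
  ⟨by simp, by simp⟩

lemma of_append (h : WellFormed R (τ ++ τ')) : WellFormed R τ := by
  constructor
  · rintro τ₁ τ₂ p i q rfl
    exact h.legal τ₁ (τ₂ ++ τ') p i q (by simp)
  · rintro τ₁ τ₂ p i q rfl
    exact h.reply τ₁ (τ₂ ++ τ') p i q (by simp)

lemma concat_req (h : WellFormed R τ) (hq : Legal R τ p i q) :
    WellFormed R (τ ++ [.req p i q]) := by
  constructor
  · intro τ₁ τ₂ p' i' q' he
    rcases concat_eq_append_cons he with ⟨rfl, he, -⟩ | ⟨l, rfl, -⟩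
    · cases he
      exact hq
    · exact h.legal _ _ _ _ _ rfl
  · intro τ₁ τ₂ p' i' r' he
    rcases concat_eq_append_cons he with ⟨rfl, he, -⟩ | ⟨l, rfl, -⟩
    · cases he
    · exact h.reply _ _ _ _ _ rfl

/-- `visibleReply` erases every reply that does not answer a request outstanding at `p`, so no
assumption on the algorithm is needed. -/
lemma concat_step (h : WellFormed R τ) (p : Pr) (i : Tid) (r : Option (Reply Tid)) :
    WellFormed R (τ ++ [.step p i (visibleReply τ p i r)]) := by
  constructor
  · intro τ₁ τ₂ p' i' q' he
    rcases concat_eq_append_cons he with ⟨rfl, he, -⟩ | ⟨l, rfl, -⟩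
    · cases he
    · exact h.legal _ _ _ _ _ rfl
  · intro τ₁ τ₂ p' i' r' he
    rcases concat_eq_append_cons he with ⟨rfl, he, -⟩ | ⟨l, rfl, -⟩
    · simp only [Obs.step.injEq, visibleReply, Option.filter_eq_some_iff, decide_eq_true_eq] at he
      obtain ⟨rfl, rfl, -, q, o, he⟩ := he
      exact ⟨q, o, he⟩
    · exact h.reply _ _ _ _ _ rfl

/-- Were there two such requests, the later one would have been submitted while the earlier one was
unanswered, against `Legal`. -/
lemma outstanding_unique (h : WellFormed R τ) (h₁ : Outstanding τ i p q)
    (h₂ : Outstanding τ i p' q') : p = p' ∧ q = q' := by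
  obtain ⟨a, b, rfl, hb⟩ := h₁
  obtain ⟨a', b', he, hb'⟩ := h₂
  rcases List.append_eq_append_iff.1 he with ⟨l, rfl, hl⟩ | ⟨l, rfl, hl⟩
  · rcases l with _ | ⟨m, l⟩
    · simp at hl; tauto
    · simp only [List.cons_append, List.cons.injEq] at hl
      obtain ⟨rfl, rfl⟩ := hl
      have := (h.legal _ _ _ _ _ he).2.1 p q
      exact absurd ⟨a, l, rfl, fun p' r hm => hb p' r (by simp [hm])⟩ this
  · rcases l with _ | ⟨m, l⟩
    · simp at hl; tauto
    · simp only [List.cons_append, List.cons.injEq] at hl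
      obtain ⟨rfl, rfl⟩ := hl
      have := (h.legal _ _ _ _ _ rfl).2.1 p' q'
      exact absurd ⟨a', l, rfl, fun p' r hm => hb' p' r (by simp [hm])⟩ this

/-- The first reply to `i` in `τ'` comes while `q` is still outstanding; as no other request of `i`
can be outstanding, this reply answers `q`. -/
lemma exists_completed (h : WellFormed R (τ ++ τ')) (h₁ : Outstanding τ i p q)
    (h₂ : ¬ Outstanding (τ ++ τ') i p q) :
    ∃ r o, Completes i q r o ∧ Completed (τ ++ τ') o ∧ .step p i (some r) ∈ τ ++ τ' := by
  have hex : ∃ m ∈ τ', ∃ p' r, m = .step p' i (some r) := by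
    by_contra! hno
    exact h₂ (h₁.append fun p' r hm => hno _ hm p' r rfl)
  obtain ⟨l₁, m, l₂, rfl, ⟨p', r, rfl⟩, hl⟩ := exists_first_split _ hex
  obtain ⟨q', o, ho, hc⟩ := h.reply (τ ++ l₁) l₂ p' i r (by simp)
  have ho' : Outstanding (τ ++ l₁) i p q := h₁.append fun p'' r' hm => hl _ hm ⟨p'', r', rfl⟩
  have hw : WellFormed R (τ ++ l₁) := by
    have : τ ++ (l₁ ++ .step p' i (some r) :: l₂) = (τ ++ l₁) ++ (.step p' i (some r) :: l₂) := by
      simp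
    rw [this] at h
    exact h.of_append
  obtain ⟨rfl, rfl⟩ := hw.outstanding_unique ho ho'
  refine ⟨r, o, hc, ⟨τ ++ l₁, l₂, p', p', i, q', r, ?_, ho, hc⟩, ?_⟩ <;> simp

lemma exists_terminate_of_commit (h : WellFormed R τ) (hc : .step p i (some .commit) ∈ τ) :
    ∃ p, .req p i .terminate ∈ τ := by
  obtain ⟨τ₁, τ₂, rfl⟩ := List.append_of_mem hc
  obtain ⟨q, o, ho, hc⟩ := h.reply _ _ _ _ _ rfl
  cases hc
  exact ⟨p, by simp [ho.mem]⟩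

end WellFormed

/-- The client of transaction `i` is waiting for nothing and the transaction is not terminated. -/
def Idle (τ : List (Obs Pr Obj Tid)) (i : Tid) : Prop :=
  ¬ Terminated τ i ∧ ∀ p q, ¬ Outstanding τ i p q

/-- A visible reply needs an outstanding request, and none can appear unless the client acts. -/
lemma Idle.append (h : Idle τ i) (hw : WellFormed R (τ ++ τ'))
    (hτ : ∀ p q, .req p i q ∉ τ') : Idle (τ ++ τ') i := by
  have key : ∀ p r, .step p i (some r) ∉ τ' := by
    intro p r hm
    obtain ⟨l₁, l₂, rfl⟩ := List.append_of_mem hm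
    obtain ⟨q, o, ho, -⟩ := hw.reply (τ ++ l₁) l₂ p i r (by simp)
    exact h.2 p q (ho.of_append fun hm => hτ p q (by simp [hm]))
  refine ⟨?_, fun p q ho => h.2 p q (ho.of_append (hτ p q))⟩
  rintro (⟨p, hp⟩ | ⟨p, hp⟩)
  · rcases List.mem_append.1 hp with hp | hp
    · exact h.1 (.inl ⟨p, hp⟩)
    · exact key _ _ hp
  · rcases List.mem_append.1 hp with hp | hp
    · exact h.1 (.inr ⟨p, hp⟩)
    · exact key _ _ hp

lemma idle_of_forall_txn_ne (h : ∀ m ∈ τ, m.txn ≠ i) : Idle τ i := by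
  refine ⟨?_, fun p q ho => h _ ho.mem rfl⟩
  rintro (⟨p, hp⟩ | ⟨p, hp⟩)
  · exact h _ hp rfl
  · exact h _ hp rfl

lemma legal_read_of_forall_txn_ne {x : Obj} (h : ∀ m ∈ τ, m.txn ≠ i) (hp : p ∈ R x) :
    Legal R τ p i (.read x) :=
  ⟨(idle_of_forall_txn_ne h).1, (idle_of_forall_txn_ne h).2, fun _ _ hm => absurd rfl (h _ hm),
    fun hm => absurd rfl (h _ hm), fun _ => hp⟩

/-! ### Traces up to reordering of the items of different transactions -/

open Classical in
/-- The items of transaction `i`. -/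
noncomputable def proj (i : Tid) (τ : List (Obs Pr Obj Tid)) : List (Obs Pr Obj Tid) :=
  τ.filter fun m => decide (m.txn = i)

lemma proj_append : proj i (τ ++ τ') = proj i τ ++ proj i τ' := by
  simp [proj]

lemma proj_eq_nil (h : ∀ m ∈ τ, m.txn ≠ i) : proj i τ = [] := by
  simpa [proj] using h

lemma mem_proj {m : Obs Pr Obj Tid} : m ∈ proj i τ ↔ m ∈ τ ∧ m.txn = i := by
  simp [proj]

/-- All client-side notions depend only on the items of the transaction concerned. This is what
makes legality, replies and completed operations insensitive to interleaving. -/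
lemma outstanding_proj : Outstanding (proj i τ) i p q ↔ Outstanding τ i p q := by
  constructor
  · rintro ⟨τ₁, τ₂, he, hr⟩
    obtain ⟨l₁, l₂, rfl, rfl, h₂⟩ := List.filter_eq_append_iff.1 he
    obtain ⟨l₃, l₄, rfl, h₃, h₄, rfl⟩ := List.filter_eq_cons_iff.1 h₂
    refine ⟨l₁ ++ l₃, l₄, by simp, fun p' r hm => hr p' r ?_⟩
    simp [hm, Obs.txn]
  · rintro ⟨τ₁, τ₂, rfl, hr⟩
    refine ⟨proj i τ₁, proj i τ₂, ?_, fun p' r hm => hr p' r (mem_proj.1 hm).1⟩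
    simp [proj, Obs.txn]

lemma req_mem_proj : .req p i q ∈ proj i τ ↔ .req p i q ∈ τ := by
  simp [mem_proj, Obs.txn]

lemma step_mem_proj {r : Option (Reply Tid)} : .step p i r ∈ proj i τ ↔ .step p i r ∈ τ := by
  simp [mem_proj, Obs.txn]

lemma terminated_proj : Terminated (proj i τ) i ↔ Terminated τ i := by
  simp only [Terminated, Aborted, step_mem_proj]

lemma legal_proj : Legal R (proj i τ) p i q ↔ Legal R τ p i q := by
  simp only [Legal, terminated_proj, outstanding_proj, req_mem_proj]

lemma completed_proj (ho : o.txn = i) : Completed (proj i τ) o ↔ Completed τ o := by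
  constructor
  · rintro ⟨τ₁, τ₂, p, p', i', q, r, he, hr, hc⟩
    obtain rfl : i' = i := by rw [← ho, hc.txn_eq]
    obtain ⟨l₁, l₂, rfl, rfl, h₂⟩ := List.filter_eq_append_iff.1 he
    obtain ⟨l₃, l₄, rfl, h₃, h₄, rfl⟩ := List.filter_eq_cons_iff.1 h₂
    refine ⟨l₁ ++ l₃, l₄, p, p', i', q, r, by simp, ?_, hc⟩
    refine (outstanding_proj.1 hr).append fun p'' r' hm => ?_
    exact h₃ _ hm (by simp [Obs.txn])
  · rintro ⟨τ₁, τ₂, p, p', i', q, r, rfl, hr, hc⟩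
    obtain rfl : i' = i := by rw [← ho, hc.txn_eq]
    exact ⟨proj i' τ₁, proj i' τ₂, p, p', i', q, r, by simp [proj, Obs.txn],
      outstanding_proj.2 hr, hc⟩

lemma legal_congr (h : proj i τ = proj i τ') : Legal R τ p i q ↔ Legal R τ' p i q := by
  rw [← legal_proj, h, legal_proj]

lemma completed_congr (h : proj o.txn τ = proj o.txn τ') : Completed τ o ↔ Completed τ' o := by
  rw [← completed_proj rfl, h, completed_proj rfl]

lemma outstanding_congr (h : proj i τ = proj i τ') :
    Outstanding τ i p q ↔ Outstanding τ' i p q := by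
  rw [← outstanding_proj, h, outstanding_proj]

lemma visibleReply_congr (h : proj i τ = proj i τ') (r : Option (Reply Tid)) :
    visibleReply τ p i r = visibleReply τ' p i r := by
  unfold visibleReply
  congr 1
  funext r'
  refine decide_eq_decide.2 ?_
  constructor <;> rintro ⟨q, o, ho, hc⟩
  · exact ⟨q, o, (outstanding_congr h).1 ho, hc⟩
  · exact ⟨q, o, (outstanding_congr h).2 ho, hc⟩

end Trace

/-! ### Finite executions: determinism and the growth of traces -/

namespace System

variable {Pr : Type w} {Obj : Type u} {Tid : Type v} {S : System.{u, v, w, s, t} Pr Obj Tid}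
  {R : Obj → Set Pr}

/-- The event is a client request. -/
def Event.IsRequest : S.Event → Prop
  | .request _ _ _ => True
  | _ => False

lemma Step.deterministic {c c₁ c₂ : S.Config} {e : S.Event} (h₁ : S.Step R c e c₁)
    (h₂ : S.Step R c e c₂) : c₁ = c₂ := by
  cases h₁ with
  | request => cases h₂; rfl
  | deliver p m rest hm =>
    cases h₂ with
    | deliver _ _ rest' hm' =>
      rw [hm, Multiset.cons_inj_right] at hm'
      rw [hm']
  | spontaneous p out ho =>
    cases h₂ with
    | spontaneous _ out' ho' =>
      rw [ho] at ho'
      cases ho'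
      rfl

lemma Step.exists_trace {c c' : S.Config} {e : S.Event} (h : S.Step R c e c') :
    ∃ m, c'.trace = c.trace ++ [m] ∧
      ∀ p i q, m = .req p i q ↔ e = .request p i q := by
  cases h with
  | request p i q hq => exact ⟨_, rfl, by simp⟩
  | deliver p m rest hm => exact ⟨_, rfl, by simp⟩
  | spontaneous p out ho => exact ⟨_, rfl, by simp⟩

lemma run_concat_iff {ρ : List S.Event} {e : S.Event} {c' : S.Config} :
    S.Run R (ρ ++ [e]) c' ↔ ∃ c, S.Run R ρ c ∧ S.Step R c e c' := by
  constructor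
  · intro h
    generalize hl : ρ ++ [e] = l at h
    cases h with
    | nil => simp at hl
    | snoc h hs =>
      obtain ⟨rfl, he⟩ := List.append_inj' hl rfl
      cases he
      exact ⟨_, h, hs⟩
  · rintro ⟨c, h, hs⟩
    exact h.snoc hs

lemma Run.deterministic {ρ : List S.Event} {c₁ c₂ : S.Config} (h₁ : S.Run R ρ c₁)
    (h₂ : S.Run R ρ c₂) : c₁ = c₂ := by
  induction h₁ generalizing c₂ with
  | nil =>
    generalize hl : ([] : List S.Event) = l at h₂
    cases h₂ with
    | nil => rfl
    | snoc => simp at hl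
  | snoc h hs ih =>
    obtain ⟨c, h', hs'⟩ := run_concat_iff.1 h₂
    obtain rfl := ih h'
    exact hs.deterministic hs'

lemma Run.wellFormed {ρ : List S.Event} {c : S.Config} (h : S.Run R ρ c) :
    WellFormed R c.trace := by
  induction h with
  | nil => exact WellFormed.nil
  | snoc h hs ih =>
    cases hs with
    | request p i q hq => exact ih.concat_req hq
    | deliver p m rest hm => exact ih.concat_step _ _ _
    | spontaneous p out ho => exact ih.concat_step _ _ _

lemma Run.exists_trace {ρ υ : List S.Event} {c c' : S.Config} (h : S.Run R ρ c)
    (h' : S.Run R (ρ ++ υ) c') :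
    ∃ τ, c'.trace = c.trace ++ τ ∧ ∀ p i q, .req p i q ∈ τ ↔ .request p i q ∈ υ := by
  induction υ using List.reverseRecOn generalizing c' with
  | nil =>
    rw [List.append_nil] at h'
    obtain rfl := h.deterministic h'
    exact ⟨[], by simp, by simp⟩
  | append_singleton υ e ih =>
    rw [← List.append_assoc] at h'
    obtain ⟨d, hd, hs⟩ := run_concat_iff.1 h'
    obtain ⟨τ, hτ, hiff⟩ := ih hd
    obtain ⟨m, hm, hiff'⟩ := hs.exists_trace
    refine ⟨τ ++ [m], by rw [hm, hτ, List.append_assoc], fun p i q => ?_⟩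
    simp only [List.mem_append, hiff, List.mem_singleton]
    rw [eq_comm, hiff', @eq_comm _ e]

-- The local state of a process changes only at its own events, and each of these leaves an item in
-- the trace.
open Classical in
lemma Run.state_eq_init {ρ : List S.Event} {c : S.Config} (h : S.Run R ρ c) {p : Pr}
    (hp : ∀ m ∈ c.trace, m.proc ≠ p) : c.state p = S.init p := by
  induction h with
  | nil => rfl
  | snoc h hs ih =>
    cases hs with
    | request p' i q hq =>
      have h₁ : p ≠ p' := (hp (.req p' i q) (by simp [Config.submit])).symm
      simp only [Config.submit, Function.update_of_ne h₁]
      exact ih fun m hm => hp m (by simp [Config.submit, hm])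
    | deliver p' m rest hm =>
      have h₁ : p ≠ p' :=
        (hp (.step p' _ _) (List.mem_append_right _ (List.mem_singleton_self _))).symm
      simp only [Config.apply, Function.update_of_ne h₁]
      exact ih fun m hm => hp m (by simp [Config.apply, hm])
    | spontaneous p' out ho =>
      have h₁ : p ≠ p' :=
        (hp (.step p' _ _) (List.mem_append_right _ (List.mem_singleton_self _))).symm
      simp only [Config.apply, Function.update_of_ne h₁]
      exact ih fun m hm => hp m (by simp [Config.apply, hm])

lemma Step.mem_net {c c' : S.Config} {e : S.Event} (h : S.Step R c e c') {p : Pr} {m : S.Msg}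
    (hm : (p, m) ∈ c.net) (he : e ≠ .deliver p m) : (p, m) ∈ c'.net := by
  cases h with
  | request => exact hm
  | deliver p' m' rest hn =>
    rw [hn, Multiset.mem_cons] at hm
    rcases hm with hm | hm
    · cases hm
      exact absurd rfl he
    · exact Multiset.mem_add.2 (.inl hm)
  | spontaneous => exact Multiset.mem_add.2 (.inl hm)

/-! ### Fair extensions of finite executions -/

section Scheduler

variable (R)

open Classical in
/-- The configuration after the attempt to execute an event. -/
noncomputable def attempt (c : S.Config) (e : S.Event) : S.Config :=
  if h : ∃ c', S.Step R c e c' then h.choose else c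

/-- The events to try again, and the messages to deliver, after the attempt of an event. -/
noncomputable def followUp (c : S.Config) (e : S.Event) : List S.Event :=
  c.net.toList.map (fun m => .deliver m.1 m.2) ++
    match e with
    | .spontaneous p => [.spontaneous p]
    | _ => []

/-- One turn of the scheduler, which keeps a queue of the events to try. -/
noncomputable def turn : S.Config × List S.Event → S.Config × List S.Event
  | (c, []) => (c, [])
  | (c, e :: Q) => (attempt R c e, Q ++ followUp (attempt R c e) e)

/-- The scheduler, started with a queue of events. -/
noncomputable def schedule (Q : List S.Event) (n : ℕ) : S.Config × List S.Event :=
  (turn R)^[n] (S.initial, Q)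

open Classical in
/-- The event executed in a turn of the scheduler. -/
noncomputable def turnEvent : S.Config × List S.Event → Option S.Event
  | (_, []) => none
  | (c, e :: _) => if ∃ c', S.Step R c e c' then some e else none

variable {R}

lemma attempt_eq {c c' : S.Config} {e : S.Event} (h : S.Step R c e c') : attempt R c e = c' := by
  have h' : ∃ c', S.Step R c e c' := ⟨c', h⟩
  rw [attempt, dif_pos h']
  exact h'.choose_spec.deterministic h

lemma schedule_succ (Q : List S.Event) (n : ℕ) :
    schedule R Q (n + 1) = turn R (schedule R Q n) :=
  Function.iterate_succ_apply' _ _ _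

variable (R) in
/-- The infinite execution produced by the scheduler. -/
noncomputable def scheduledRun (Q : List S.Event) : S.InfRun R where
  cfg n := (schedule R Q n).1
  ev n := turnEvent R (schedule R Q n)
  start := rfl
  pause n h := by
    rw [schedule_succ]
    generalize schedule R Q n = d at h
    rcases d with ⟨c, _ | ⟨e, l⟩⟩
    · rfl
    · simp only [turnEvent, ite_eq_right_iff, reduceCtorEq, imp_false] at h
      simp [turn, attempt, h]
  step n e h := by
    rw [schedule_succ]
    generalize schedule R Q n = d at h
    rcases d with ⟨c, _ | ⟨e', l⟩⟩
    · simp [turnEvent] at h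
    · simp only [turnEvent, Option.ite_none_right_eq_some, Option.some.injEq] at h
      obtain ⟨⟨c', hc⟩, rfl⟩ := h
      simpa [turn, attempt_eq hc] using hc

/-- The queue is first in, first out: each turn consumes the head and only adds at the end. -/
lemma schedule_drop {Q l₁ l₂ : List S.Event} {n : ℕ} (h : (schedule R Q n).2 = l₁ ++ l₂) :
    ∃ l₃, (schedule R Q (n + l₁.length)).2 = l₂ ++ l₃ := by
  induction l₁ generalizing n l₂ with
  | nil => exact ⟨[], by simpa using h⟩
  | cons e l ih =>
    have h' : (schedule R Q (n + 1)).2 =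
        l ++ (l₂ ++ followUp (attempt R (schedule R Q n).1 e) e) := by
      rw [schedule_succ]
      generalize schedule R Q n = d at h
      rcases d with ⟨c, Q'⟩
      simp only at h
      subst h
      simp [turn]
    obtain ⟨l₃, h₃⟩ := ih h'
    refine ⟨followUp (attempt R (schedule R Q n).1 e) e ++ l₃, ?_⟩
    rw [List.length_cons, add_comm l.length 1, ← add_assoc, h₃, List.append_assoc]

lemma exists_head {Q : List S.Event} {n : ℕ} {e : S.Event} (h : e ∈ (schedule R Q n).2) :
    ∃ m ≥ n, ∃ l, (schedule R Q m).2 = e :: l := by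
  obtain ⟨l₁, l₂, h⟩ := List.append_of_mem h
  obtain ⟨l₃, h₃⟩ := schedule_drop h
  exact ⟨_, Nat.le_add_right _ _, _, h₃⟩

lemma spontaneous_mem_schedule {Q : List S.Event} {p : Pr} (h : .spontaneous p ∈ Q) (n : ℕ) :
    .spontaneous p ∈ (schedule R Q n).2 := by
  induction n with
  | zero => exact h
  | succ n ih =>
    rw [schedule_succ]
    generalize schedule R Q n = d at ih
    rcases d with ⟨c, _ | ⟨e, l⟩⟩
    · simp at ih
    · rcases List.mem_cons.1 ih with rfl | ih
      · simp [turn, followUp]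
      · simp [turn, ih]

/-- Each turn on a non-empty queue enqueues a delivery for every message then in transit, new or
old. Redundant deliveries do no harm, since an attempt of an impossible event is a pause. -/
lemma deliver_mem_schedule {Q : List S.Event} {p : Pr} {m : S.Msg} {n : ℕ}
    (h : (p, m) ∈ (schedule R Q n).1.net) : .deliver p m ∈ (schedule R Q n).2 := by
  induction n with
  | zero => simp [schedule, initial] at h
  | succ n ih =>
    rw [schedule_succ] at h ⊢
    generalize schedule R Q n = d at ih h
    rcases d with ⟨c, _ | ⟨e, l⟩⟩
    · exact ih h
    · have h' : (p, m) ∈ (attempt R c e).net := h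
      simp only [turn, followUp, List.mem_append, List.mem_map, Multiset.mem_toList]
      exact .inr (.inl ⟨_, h', rfl⟩)

lemma turnEvent_eq {d : S.Config × List S.Event} {e : S.Event} {l : List S.Event} {c' : S.Config}
    (h : d.2 = e :: l) (hs : S.Step R d.1 e c') : turnEvent R d = some e := by
  rcases d with ⟨c, Q⟩
  simp only at h hs
  subst h
  simp only [turnEvent]
  rw [if_pos ⟨c', hs⟩]

/-- Spontaneous steps are put back into the queue after each attempt, so each comes to the head
infinitely often. A message that is never delivered stays in transit, hence its delivery is possible
when it comes to the head. -/
lemma scheduledRun_fair {Q : List S.Event} (h : ∀ p, .spontaneous p ∈ Q) :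
    (scheduledRun R Q).Fair := by
  constructor
  · intro p n
    obtain ⟨m, hm, l, hl⟩ := exists_head (spontaneous_mem_schedule (R := R) (h p) n)
    refine ⟨m, hm, ?_⟩
    cases ho : S.spontaneous p (((scheduledRun R Q).cfg m).state p) with
    | none => exact .inl rfl
    | some out => exact .inr (turnEvent_eq hl (.spontaneous _ p out ho))
  · intro n p msg hn
    by_contra! hno
    have stay : ∀ k, (p, msg) ∈ ((scheduledRun R Q).cfg (n + k)).net := by
      intro k
      induction k with
      | zero => exact hn
      | succ k ih =>
        cases he : (scheduledRun R Q).ev (n + k) with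
        | none =>
          rw [← add_assoc, (scheduledRun R Q).pause _ he]
          exact ih
        | some e =>
          refine ((scheduledRun R Q).step _ _ he).mem_net ih ?_
          rintro rfl
          exact hno _ (Nat.le_add_right _ _) he
    obtain ⟨m, hm, l, hl⟩ := exists_head (deliver_mem_schedule hn)
    obtain ⟨k, rfl⟩ := Nat.exists_eq_add_of_le hm
    obtain ⟨rest, hr⟩ := Multiset.exists_cons_of_mem (stay k)
    exact hno _ hm (turnEvent_eq hl (.deliver _ p msg rest hr))

lemma InfRun.events_succ (σ : S.InfRun R) (n : ℕ) :
    σ.events (n + 1) = σ.events n ++ (σ.ev n).toList := by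
  cases h : σ.ev n <;> simp [events, List.range_succ, h]

lemma InfRun.run (σ : S.InfRun R) (n : ℕ) : S.Run R (σ.events n) (σ.cfg n) := by
  induction n with
  | zero =>
    rw [σ.start]
    exact .nil
  | succ n ih =>
    rw [σ.events_succ]
    cases h : σ.ev n with
    | none => simpa [σ.pause n h] using ih
    | some e => exact ih.snoc (σ.step n e h)

lemma followUp_not_isRequest (c : S.Config) (e : S.Event) :
    ∀ e' ∈ followUp c e, ¬ e'.IsRequest := by
  intro e' he
  rcases List.mem_append.1 he with he | he
  · obtain ⟨m, -, rfl⟩ := List.mem_map.1 he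
    exact id
  · cases e <;> simp at he
    subst he
    exact id

/-- With `ρ` at the front of the initial queue, the scheduler first replays `ρ` exactly. What it
adds meanwhile contains no request, so no client acts afterwards unless `Q` says so. -/
lemma schedule_run {ρ : List S.Event} {c : S.Config} (h : S.Run R ρ c) (Q : List S.Event) :
    ∃ l, schedule R (ρ ++ Q) ρ.length = (c, Q ++ l) ∧ (∀ e ∈ l, ¬ e.IsRequest) ∧
      (scheduledRun R (ρ ++ Q)).events ρ.length = ρ := by
  induction h generalizing Q with
  | nil => exact ⟨[], by simp [schedule], by simp, rfl⟩
  | @snoc ρ c c' e h hs ih =>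
    -- The last event of the execution is counted as the first one of the remaining queue.
    obtain ⟨l, hl, hr, he⟩ := ih (e :: Q)
    have hev : (scheduledRun R (ρ ++ e :: Q)).ev ρ.length = some e :=
      turnEvent_eq (l := Q ++ l) (c' := c') (by rw [hl]; rfl) (by rw [hl]; exact hs)
    refine ⟨l ++ followUp c' e, ?_, ?_, ?_⟩
    · rw [List.length_append, List.length_singleton, schedule_succ, List.append_assoc,
        List.singleton_append, hl]
      simp [turn, attempt_eq hs]
    · intro e' he'
      rcases List.mem_append.1 he' with he' | he'
      · exact hr _ he'
      · exact followUp_not_isRequest _ _ _ he'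
    · rw [List.length_append, List.length_singleton, InfRun.events_succ, List.append_assoc,
        List.singleton_append, he, hev]
      rfl

lemma schedule_not_isRequest {Q : List S.Event} {n : ℕ}
    (h : ∀ e ∈ (schedule R Q n).2, ¬ e.IsRequest) (k : ℕ) :
    ∀ e ∈ (schedule R Q (n + k)).2, ¬ e.IsRequest := by
  induction k with
  | zero => exact h
  | succ k ih =>
    rw [← add_assoc, schedule_succ]
    generalize schedule R Q (n + k) = d at ih
    rcases d with ⟨c, _ | ⟨e, l⟩⟩
    · exact ih
    · intro e' he'
      rcases List.mem_append.1 he' with he' | he'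
      · exact ih _ (List.mem_cons_of_mem _ he')
      · exact followUp_not_isRequest _ _ _ he'

/-- Every finite execution is a prefix of a fair one without further requests. -/
lemma Run.exists_fair [Finite Pr] {ρ : List S.Event} {c : S.Config} (h : S.Run R ρ c) :
    ∃ σ : S.InfRun R, σ.Fair ∧ σ.cfg ρ.length = c ∧
      ∀ n, ∃ υ, σ.events (ρ.length + n) = ρ ++ υ ∧ ∀ p i q, .request p i q ∉ υ := by
  obtain ⟨P, hP⟩ : ∃ P : List Pr, ∀ p, p ∈ P := by
    have := Fintype.ofFinite Pr
    exact ⟨Finset.univ.toList, by simp⟩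
  set Q : List S.Event := P.map .spontaneous with hQ
  obtain ⟨l, hl, hr, he⟩ := schedule_run h Q
  refine ⟨scheduledRun R (ρ ++ Q), scheduledRun_fair fun p => ?_, ?_, fun n => ?_⟩
  · simp [hQ, hP]
  · change (schedule R (ρ ++ Q) ρ.length).1 = c
    rw [hl]
  · have hnr : ∀ e ∈ (schedule R (ρ ++ Q) ρ.length).2, ¬ e.IsRequest := by
      rw [hl]
      intro e he
      rcases List.mem_append.1 he with he | he
      · obtain ⟨p, -, rfl⟩ := List.mem_map.1 he
        exact id
      · exact hr _ he
    induction n with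
    | zero => exact ⟨[], by simpa using he, by simp⟩
    | succ n ih =>
      obtain ⟨υ, hυ, hno⟩ := ih
      refine ⟨υ ++ ((scheduledRun R (ρ ++ Q)).ev (ρ.length + n)).toList, ?_, ?_⟩
      · rw [← add_assoc, InfRun.events_succ, hυ, List.append_assoc]
      · intro p i q hm
        rcases List.mem_append.1 hm with hm | hm
        · exact hno _ _ _ hm
        · have h₁ := schedule_not_isRequest hnr n
          have h₂ : turnEvent R (schedule R (ρ ++ Q) (ρ.length + n)) = some (.request p i q) := by
            exact Option.mem_toList.1 hm
          generalize schedule R (ρ ++ Q) (ρ.length + n) = d at h₁ h₂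
          rcases d with ⟨c', _ | ⟨e, Q'⟩⟩
          · simp [turnEvent] at h₂
          · simp only [turnEvent, Option.ite_none_right_eq_some, Option.some.injEq] at h₂
            obtain ⟨-, rfl⟩ := h₂
            exact h₁ _ (List.mem_cons_self ..) trivial

end Scheduler

end System

/-! ### From liveness and genuine partial replication to locality of steps -/

namespace WellFormed

variable {Pr : Type w} {Obj : Type u} {Tid : Type v} {R : Obj → Set Pr}
  {τ : List (Obs Pr Obj Tid)} {i : Tid} {p p' : Pr} {q q' : Request Obj}

lemma req_proc_unique (h : WellFormed R τ) (h₁ : .req p i q ∈ τ) (h₂ : .req p' i q' ∈ τ) :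
    p = p' := by
  obtain ⟨a, b, rfl⟩ := List.append_of_mem h₁
  rcases List.mem_append.1 h₂ with h₂ | h₂
  · exact ((h.legal _ _ _ _ _ rfl).2.2.1 _ _ h₂).symm
  · rcases List.mem_cons.1 h₂ with h₂ | h₂
    · cases h₂
      rfl
    · obtain ⟨a', b', rfl⟩ := List.append_of_mem h₂
      exact (h.legal (a ++ .req p i q :: a') b' p' i q' (by simp)).2.2.1 p q (by simp)

end WellFormed

namespace System

variable {Pr : Type w} {Obj : Type u} {Tid : Type v} {S : System.{u, v, w, s, t} Pr Obj Tid}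
  {R : Obj → Set Pr} {F : List S.Event → History Obj Tid}

lemma InfRun.exists_trace (σ : S.InfRun R) (n k : ℕ) :
    ∃ τ, (σ.cfg (n + k)).trace = (σ.cfg n).trace ++ τ := by
  induction k with
  | zero => exact ⟨[], by simp⟩
  | succ k ih =>
    obtain ⟨τ, hτ⟩ := ih
    rw [← add_assoc]
    cases he : σ.ev (n + k) with
    | none => exact ⟨τ, by rw [σ.pause _ he, hτ]⟩
    | some e =>
      obtain ⟨m, hm, -⟩ := (σ.step _ _ he).exists_trace
      exact ⟨τ ++ [m], by rw [hm, hτ, List.append_assoc]⟩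

/-- The liveness hypotheses are applied to a fair extension without requests and cut back to a
finite execution. Whether `i` is an update or a query decides which of the two applies. -/
lemma Run.exists_answer [Finite Pr] (hOFU : S.ObstructionFreeUpdates R F)
    (hWFQ : S.WaitFreeQueries R) {ρ : List S.Event} {c : S.Config} (h : S.Run R ρ c) (i : Tid) :
    ∃ υ c' τ, S.Run R (ρ ++ υ) c' ∧ c'.trace = c.trace ++ τ ∧ (∀ p i' q, .req p i' q ∉ τ) ∧
      (∀ p q, ¬ Outstanding c'.trace i p q) ∧
      ((∀ j, i ≠ j → ¬ WriteConflict c.trace i j) → ¬ Aborted c'.trace i) := by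
  obtain ⟨σ, hfair, hc, hext⟩ := h.exists_fair
  have hrun : ∀ k, ∃ υ τ, S.Run R (ρ ++ υ) (σ.cfg (ρ.length + k)) ∧
      (σ.cfg (ρ.length + k)).trace = c.trace ++ τ ∧ ∀ p i' q, .req p i' q ∉ τ := by
    intro k
    obtain ⟨υ, he, hno⟩ := hext k
    have hr := σ.run (ρ.length + k)
    rw [he] at hr
    obtain ⟨τ, hτ, hiff⟩ := h.exists_trace hr
    exact ⟨υ, τ, hr, hτ, fun p i' q hm => hno p i' q ((hiff p i' q).1 hm)⟩
  have hnc : (∀ j, i ≠ j → ¬ WriteConflict c.trace i j) →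
      ∀ n j, (F (σ.events n)).Concurrent i j → ¬ WriteConflict (σ.cfg n).trace i j := by
    rintro hcf n j ⟨hij, -⟩ ⟨x, ⟨p, hp⟩, p', hp'⟩
    -- The trace at time `n` and `c.trace` are both prefixes of the trace at time `ρ.length + n`,
    -- and only requests of `c.trace` occur there. So conflicts at any time are already conflicts in
    -- `c.trace`.
    obtain ⟨τ₁, h₁⟩ := σ.exists_trace n ρ.length
    obtain ⟨υ, τ, -, h₂, hno⟩ := hrun n
    rw [add_comm, h₂] at h₁
    have key : ∀ p i', .req p i' (.write x) ∈ (σ.cfg n).trace →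
        .req p i' (.write x) ∈ c.trace := by
      intro p i' hm
      have : .req p i' (.write x) ∈ c.trace ++ τ := h₁ ▸ List.mem_append_left _ hm
      exact (List.mem_append.1 this).resolve_right (hno _ _ _)
    exact hcf j hij ⟨x, ⟨p, key _ _ hp⟩, p', key _ _ hp'⟩
  obtain ⟨hans, hab⟩ : σ.Answers i ∧ ((∀ j, i ≠ j → ¬ WriteConflict c.trace i j) →
      ∀ n, ¬ Aborted (σ.cfg n).trace i) := by
    by_cases hu : σ.Updates i
    · exact ⟨(hOFU σ hfair i hu).1, fun hcf => (hOFU σ hfair i hu).2 (hnc hcf)⟩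
    · exact ⟨(hWFQ σ hfair i hu).1, fun _ => (hWFQ σ hfair i hu).2⟩
  by_cases hex : ∃ p q, Outstanding c.trace i p q
  · obtain ⟨p, q, ho⟩ := hex
    obtain ⟨m, hm, hno⟩ := hans ρ.length p q (by rwa [hc])
    obtain ⟨k, rfl⟩ := Nat.exists_eq_add_of_le hm
    obtain ⟨υ, τ, hr, hτ, hreq⟩ := hrun k
    refine ⟨υ, _, τ, hr, hτ, hreq, fun p' q' ho' => ?_, fun hcf => hab hcf _⟩
    have ho'' : Outstanding c.trace i p' q' := by
      rw [hτ] at ho'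
      exact ho'.of_append (hreq _ _ _)
    obtain ⟨rfl, rfl⟩ := h.wellFormed.outstanding_unique ho ho''
    exact hno ho'
  · push Not at hex
    refine ⟨[], c, [], by simpa using h, by simp, by simp, hex, fun hcf => ?_⟩
    rw [← hc]
    exact hab hcf _

/-- A transaction is executed only at replicas of the objects it has accessed so far, if it has
accessed any. -/
lemma Run.step_mem_replicas_of_req [Finite Pr] (hGPR : S.GPR R)
    (hOFU : S.ObstructionFreeUpdates R F) (hWFQ : S.WaitFreeQueries R) {ρ : List S.Event}
    {c : S.Config} (h : S.Run R ρ c) {p p₀ : Pr} {i : Tid} {r : Option (Reply Tid)}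
    {q₀ : Request Obj} (hs : .step p i r ∈ c.trace) (hq : .req p₀ i q₀ ∈ c.trace) :
    ∃ x ∈ accessed c.trace i, p ∈ R x := by
  obtain ⟨υ, c₁, τ, h₁, hτ, hreq, hno, -⟩ := h.exists_answer hOFU hWFQ i
  have hacc : accessed c₁.trace i = accessed c.trace i := by
    ext x
    simp [accessed, hτ, hreq]
  rw [← hacc]
  have hs₁ : .step p i r ∈ c₁.trace := by simp [hτ, hs]
  have hq₁ : .req p₀ i q₀ ∈ c₁.trace := by simp [hτ, hq]
  by_cases ht : Terminated c₁.trace i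
  · exact hGPR _ _ h₁ i ht p r hs₁
  -- A termination request accesses no object, so once it is answered genuine partial replication
  -- applies to the same set of accessed objects.
  · have hl : Legal R c₁.trace p₀ i .terminate :=
      ⟨ht, hno, fun p' q' hm => h₁.wellFormed.req_proc_unique hm hq₁, q₀, hq₁⟩
    have h₂ := h₁.snoc (.request _ _ _ _ hl)
    obtain ⟨υ', c₃, τ', h₃, hτ', hreq', hno', -⟩ := h₂.exists_answer hOFU hWFQ i
    have hacc' : accessed c₃.trace i = accessed c₁.trace i := by
      ext x
      simp [accessed, hτ', hreq', Config.submit]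
    rw [← hacc']
    have hw := h₃.wellFormed
    have hno₃ := hno' p₀ .terminate
    rw [hτ'] at hw hno₃
    obtain ⟨r', o, hc, -, hm⟩ := hw.exists_completed outstanding_concat_req hno₃
    refine hGPR _ _ h₃ i ?_ p r (by simp [hτ', Config.submit, hs₁])
    rw [← hτ'] at hm
    cases hc with
    | commit => exact .inl ⟨_, hm⟩
    | abort => exact .inr ⟨_, hm⟩

/-- Every step is made to execute a transaction that has already accessed an object replicated
by the process. -/
lemma Run.step_mem_replicas [Finite Pr] (hGPR : S.GPR R)
    (hOFU : S.ObstructionFreeUpdates R F) (hWFQ : S.WaitFreeQueries R) {x y : Obj}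
    (hx : (R x).Nonempty) (hy : (R y).Nonempty) (hxy : Disjoint (R x) (R y)) {ρ : List S.Event}
    {c : S.Config} (h : S.Run R ρ c) {p : Pr} {i : Tid} {r : Option (Reply Tid)}
    (hs : .step p i r ∈ c.trace) :
    ∃ x ∈ accessed c.trace i, p ∈ R x := by
  by_cases hex : ∃ p₀ q₀, .req p₀ i q₀ ∈ c.trace
  · obtain ⟨p₀, q₀, hq⟩ := hex
    exact h.step_mem_replicas_of_req hGPR hOFU hWFQ hs hq
  · exfalso
    push Not at hex
    -- A step for a transaction that has not asked for anything is premature: the client may still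
    -- choose a first object `z` that `p` does not replicate. Disjointness of the two replica sets
    -- provides `z`.
    obtain ⟨z, ⟨p₀, hp₀⟩, hz⟩ : ∃ z, (R z).Nonempty ∧ p ∉ R z := by
      by_cases hp : p ∈ R x
      · exact ⟨y, hy, Set.disjoint_left.1 hxy hp⟩
      · exact ⟨x, hx, hp⟩
    have ht : ¬ Terminated c.trace i := by
      intro ht
      obtain ⟨z, ⟨p', hp'⟩, -⟩ := hGPR _ _ h i ht p r hs
      exact hp'.elim (hex _ _) (hex _ _)
    have hl : Legal R c.trace p₀ i (.read z) :=
      ⟨ht, fun p' q' ho => hex _ _ ho.mem, fun p' q' hm => absurd hm (hex _ _),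
        hex _ _, fun _ => hp₀⟩
    have h₁ := h.snoc (.request _ _ _ _ hl)
    obtain ⟨z', ⟨p', hp'⟩, hz'⟩ := h₁.step_mem_replicas_of_req hGPR hOFU hWFQ (p := p) (i := i)
      (r := r) (p₀ := p₀) (q₀ := .read z) (by simp [Config.submit, hs]) (by simp [Config.submit])
    simp only [Config.submit, List.mem_append, hex, List.mem_singleton, false_or,
      Obs.req.injEq, Request.read.injEq, reduceCtorEq, and_false, or_false, true_and] at hp'
    obtain ⟨-, rfl⟩ := hp'
    exact hz hz'

/-! ### Executions at disjoint sets of processes -/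

open Classical in
/-- An execution can be appended to another one that involves other processes and other
transactions. -/
lemma Run.append_run {ρ₁ ρ₂ : List S.Event} {c₁ c₂ : S.Config} (h₁ : S.Run R ρ₁ c₁)
    (h₂ : S.Run R ρ₂ c₂) {P : Set Pr} (hP₁ : ∀ m ∈ c₁.trace, m.proc ∉ P)
    (hP₂ : ∀ m ∈ c₂.trace, m.proc ∈ P)
    (ht : ∀ m ∈ c₁.trace, ∀ m' ∈ c₂.trace, m.txn ≠ m'.txn) :
    S.Run R (ρ₁ ++ ρ₂) ⟨fun p => if p ∈ P then c₂.state p else c₁.state p, c₁.net + c₂.net,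
      c₁.trace ++ c₂.trace⟩ := by
  induction h₂ with
  | nil =>
    convert h₁ using 1
    · simp
    · rcases c₁ with ⟨st, net, tr⟩
      simp only [initial, add_zero, List.append_nil, Config.mk.injEq, and_true]
      funext p
      split_ifs with hp
      · exact (h₁.state_eq_init fun m hm he => hP₁ m hm (he ▸ hp)).symm
      · rfl
  | @snoc ρ c c' e h hs ih =>
    obtain ⟨m, hm, -⟩ := hs.exists_trace
    have ih := ih (fun m' hm' => hP₂ m' (by simp [hm, hm']))
      (fun m₁ h₁ m' hm' => ht m₁ h₁ m' (by simp [hm, hm']))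
    have hmP : m.proc ∈ P := hP₂ m (by simp [hm])
    have hmt : ∀ m₁ ∈ c₁.trace, m₁.txn ≠ m.txn := fun m₁ h₁ => ht m₁ h₁ m (by simp [hm])
    -- The first execution has no item of this transaction, so legality and visible replies are as
    -- in the second execution alone.
    have hproj : proj m.txn (c₁.trace ++ c.trace) = proj m.txn c.trace := by
      rw [proj_append, proj_eq_nil hmt, List.nil_append]
    have hupd : ∀ (p : Pr) (s : S.State), p ∈ P →
        Function.update (fun p => if p ∈ P then c.state p else c₁.state p) p s =
        fun p' => if p' ∈ P then Function.update c.state p s p' else c₁.state p' := by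
      intro p s hp
      funext p'
      by_cases he : p' = p
      · subst he
        simp [hp]
      · simp [Function.update_of_ne he]
    rw [← List.append_assoc]
    cases hs with
    | request p i q hq =>
      obtain rfl : .req p i q = m := by simpa [Config.submit] using hm
      have hs' := ih.snoc (.request _ p i q ((legal_congr hproj).2 hq))
      have hp : p ∈ P := hmP
      simp only [Config.submit, if_pos hp, hupd _ _ hp, List.append_assoc] at hs' ⊢
      exact hs'
    | deliver p msg rest hn =>
      obtain rfl : _ = m := by simpa [Config.apply] using hm
      have hs' := ih.snoc (.deliver _ p msg (c₁.net + rest) (by simp [hn]))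
      have hp : p ∈ P := hmP
      simp only [Config.apply, if_pos hp, hupd _ _ hp, List.append_assoc] at hs' ⊢
      have := visibleReply_congr (p := p) hproj (S.receive p msg (c.state p)).reply
      simp only [Obs.txn] at this
      rw [this] at hs'
      simpa [add_assoc] using hs'
    | spontaneous p out ho =>
      obtain rfl : _ = m := by simpa [Config.apply] using hm
      have hp : p ∈ P := hmP
      have hs' := ih.snoc (.spontaneous _ p out (by simpa [hp] using ho))
      simp only [Config.apply, hupd _ _ hp, List.append_assoc] at hs' ⊢
      have := visibleReply_congr (p := p) hproj out.reply
      simp only [Obs.txn] at this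
      rw [this] at hs'
      simpa [add_assoc] using hs'

/-- The continuation of an execution depends only on the states, on the messages in transit, and
on the trace of each transaction. -/
lemma Run.transfer {ρ ρ' υ : List S.Event} {c c' d : S.Config} (h : S.Run R ρ c)
    (h' : S.Run R (ρ ++ υ) c') (hd : S.Run R ρ' d) (hst : c.state = d.state)
    (hnet : c.net = d.net) (htr : ∀ i, proj i c.trace = proj i d.trace) :
    ∃ d', S.Run R (ρ' ++ υ) d' ∧ c'.state = d'.state ∧ c'.net = d'.net ∧
      ∀ i, proj i c'.trace = proj i d'.trace := by
  induction υ using List.reverseRecOn generalizing c' with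
  | nil =>
    rw [List.append_nil] at h'
    obtain rfl := h.deterministic h'
    exact ⟨d, by simpa using hd, hst, hnet, htr⟩
  | append_singleton υ e ih =>
    rw [← List.append_assoc] at h'
    obtain ⟨b, hb, hs⟩ := run_concat_iff.1 h'
    obtain ⟨b', hb', hst', hnet', htr'⟩ := ih hb
    rw [← List.append_assoc]
    cases hs with
    | request p i q hq =>
      refine ⟨_, hb'.snoc (.request _ p i q ((legal_congr (htr' i)).1 hq)), ?_, hnet', ?_⟩
      · simp [Config.submit, hst']
      · intro j
        simp [Config.submit, proj_append, htr']
    | deliver p msg rest hn =>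
      refine ⟨_, hb'.snoc (.deliver _ p msg rest (by rw [← hnet', hn])), ?_, ?_, ?_⟩
      · simp [Config.apply, hst']
      · simp [Config.apply, hst']
      · intro j
        simp only [Config.apply, hst', proj_append, htr', visibleReply_congr (htr' _)]
    | spontaneous p out ho =>
      refine ⟨_, hb'.snoc (.spontaneous _ p out (by rw [← hst', ho])), ?_, ?_, ?_⟩
      · simp [Config.apply, hst']
      · simp [Config.apply, hnet']
      · intro j
        simp only [Config.apply, proj_append, htr', visibleReply_congr (htr' _)]

end System

section Trace

variable {Pr : Type w} {Obj : Type u} {Tid : Type v} {R : Obj → Set Pr}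
  {τ : List (Obs Pr Obj Tid)} {i : Tid} {o : Op Obj Tid}

lemma Completed.append_left (τ' : List (Obs Pr Obj Tid)) (h : Completed τ o) :
    Completed (τ' ++ τ) o := by
  obtain ⟨τ₁, τ₂, p, p', i, q, r, rfl, ⟨l₁, l₂, rfl, hl⟩, hc⟩ := h
  exact ⟨τ' ++ (l₁ ++ .req p i q :: l₂), τ₂, p, p', i, q, r, by simp,
    ⟨τ' ++ l₁, l₂, by simp, hl⟩, hc⟩

lemma WellFormed.not_terminated (h : WellFormed R τ) (ha : ¬ Aborted τ i)
    (ht : ∀ p, .req p i .terminate ∉ τ) : ¬ Terminated τ i := by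
  rintro (⟨p, hp⟩ | hp)
  · obtain ⟨p', hp'⟩ := h.exists_terminate_of_commit hp
    exact ht p' hp'
  · exact ha hp

end Trace

/-! ### Snapshot isolation with snapshots at first operations -/

namespace History

variable {Obj : Type u} {Tid : Type v} {h : History Obj Tid}

lemma IsHistory.asymm (hh : h.IsHistory) {a b : Op Obj Tid} (hab : h.lt a b) : ¬ h.lt b a :=
  fun hba => hh.irrefl _ (hh.trans _ _ _ hab hba)

/-- The single read of `x` by `i` comes before its write of `x`, whereas reading `x_i` would put the
write first. -/
lemma IsHistory.not_read_self (hh : h.IsHistory) (i : Tid) (x : Obj) :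
    .read i x (some i) ∉ h.ops := by
  intro hr
  have h₁ := hh.reads_from _ _ _ hr
  obtain ⟨v, h₂⟩ := hh.read_before_write i x (hh.mem_of_lt _ _ h₁).1
  obtain rfl := hh.read_once _ _ _ _ hr (hh.mem_of_lt _ _ h₂).1
  exact hh.asymm h₁ h₂

/-- A history is in `SI` if the snapshot points can be taken right before the first operations. -/
lemma inSI_of_first_operation (hm : ∀ a b, h.lt a b → a ∈ h.ops ∧ b ∈ h.ops)
    (hi : ∀ a, ¬ h.lt a a) (ht : ∀ a b c, h.lt a b → h.lt b c → h.lt a c)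
    (hread : ∀ i x j, .read i x (some j) ∈ h.ops →
      .commit j ∈ h.ops ∧ ∀ a ∈ h.ops, a.txn = i → h.lt (.commit j) a)
    (hfresh : ∀ i x ver k, .read i x ver ∈ h.ops → .write k x ∈ h.ops → .commit k ∈ h.ops →
      ver ≠ some k → ∃ a ∈ h.ops, a.txn = i ∧ (a = .commit k ∨ h.lt a (.commit k)))
    (hwrite : ∀ i j x, .write i x ∈ h.ops → .write j x ∈ h.ops → i = j) : h.InSI := by
  -- the operations after, and before, the snapshot point of `i`
  let U : Tid → Op Obj Tid → Prop := fun i b => ∃ a ∈ h.ops, a.txn = i ∧ (a = b ∨ h.lt a b)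
  let D : Tid → Op Obj Tid → Prop := fun i a => a ∈ h.ops ∧ ∀ b, U i b → h.lt a b
  have hU : ∀ i a b, U i a → h.lt a b → U i b := by
    rintro i a b ⟨e, he, het, rfl | hea⟩ hab
    · exact ⟨e, he, het, .inr hab⟩
    · exact ⟨e, he, het, .inr (ht _ _ _ hea hab)⟩
  have hD : ∀ i a b, h.lt a b → D i b → D i a := fun i a b hab hb =>
    ⟨(hm _ _ hab).1, fun e he => ht _ _ _ hab (hb.2 e he)⟩
  -- The point of `i` is inserted in the cut between the down-set `D i` and the up-set `U i`; two
  -- points are ordered only if some operation separates them. A transaction without operations gets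
  -- its point after all of `h`.
  refine ⟨fun a b => match a, b with
    | .inl a, .inl b => h.lt a b
    | .inl a, .inr i => D i a
    | .inr i, .inl b => U i b
    | .inr i, .inr j => ∃ a, U i a ∧ D j a, ⟨?_, ?_, ?_, ?_⟩, ?_, ?_, ?_⟩
  · rintro (a | i)
    · exact hi a
    · rintro ⟨a, h₁, h₂⟩
      exact hi _ (h₂.2 a h₁)
  · rintro (a | i) (b | j) (c | k) h₁ h₂
    · exact ht _ _ _ h₁ h₂
    · exact hD _ _ _ h₁ h₂
    · exact h₁.2 _ h₂
    · obtain ⟨b, hb₁, hb₂⟩ := h₂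
      exact hD _ _ _ (h₁.2 _ hb₁) hb₂
    · exact hU _ _ _ h₁ h₂
    · exact ⟨b, h₁, h₂⟩
    · obtain ⟨b, hb₁, hb₂⟩ := h₁
      exact hU _ _ _ hb₁ (hb₂.2 _ h₂)
    · obtain ⟨b, hb₁, hb₂⟩ := h₁
      obtain ⟨c, hc₁, hc₂⟩ := h₂
      exact ⟨c, hU _ _ _ hb₁ (hb₂.2 _ hc₁), hc₂⟩
  · exact fun a _ b _ => Iff.rfl
  · exact fun a ha => ⟨a, ha, rfl, .inl rfl⟩
  · intro i x j hr _
    obtain ⟨hc, hlt⟩ := hread i x j hr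
    refine ⟨hc, hc, ?_⟩
    rintro b ⟨a, ha, hat, rfl | hab⟩
    · exact hlt _ ha hat
    · exact ht _ _ _ (hlt _ ha hat) hab
  · intro i x ver k hr _ hw hc hne
    exact .inr (hfresh i x ver k hr hw hc hne)
  · intro i j x hij _ _ hwi hwj
    exact absurd (hwrite i j x hwi hwj) hij

/-- The appended read is maximal, so the first operations of transactions already present do not
move. Freshness of the new read is automatic because `j` is the only writer of `x`. -/
lemma IsHistory.inSI_snoc_read (hh : h.IsHistory) {i : Tid} {x : Obj} {j : Tid}
    (ho : .read i x (some j) ∉ h.ops) (hj : h.CommittedBefore i x (some j))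
    (hread : ∀ i x j, .read i x (some j) ∈ h.ops →
      .commit j ∈ h.ops ∧ ∀ a ∈ h.ops, a.txn = i → h.lt (.commit j) a)
    (hfresh : ∀ i x ver k, .read i x ver ∈ h.ops → .write k x ∈ h.ops → .commit k ∈ h.ops →
      ver ≠ some k → ∃ a ∈ h.ops, a.txn = i ∧ (a = .commit k ∨ h.lt a (.commit k)))
    (hwrite : ∀ i j x, .write i x ∈ h.ops → .write j x ∈ h.ops → i = j) :
    (h.snoc (.read i x (some j))).InSI := by
  have hmem : ∀ a, a ∈ (h.snoc (.read i x (some j))).ops ↔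
      a = .read i x (some j) ∨ a ∈ h.ops := fun a => Iff.rfl
  have hlt : ∀ a b, (h.snoc (.read i x (some j))).lt a b ↔
      h.lt a b ∨ (a ∈ h.ops ∧ b = .read i x (some j)) := fun a b => Iff.rfl
  obtain ⟨hjw, hjc, hja⟩ := hj j rfl
  apply inSI_of_first_operation
  · simp only [hmem, hlt]
    rintro a b (hab | ⟨ha, rfl⟩)
    · exact ⟨.inr (hh.mem_of_lt _ _ hab).1, .inr (hh.mem_of_lt _ _ hab).2⟩
    · exact ⟨.inr ha, .inl rfl⟩
  · simp only [hlt]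
    rintro a (ha | ⟨ha, rfl⟩)
    · exact hh.irrefl _ ha
    · exact ho ha
  · simp only [hlt]
    rintro a b c (hab | ⟨ha, rfl⟩) (hbc | ⟨hb, rfl⟩)
    · exact .inl (hh.trans _ _ _ hab hbc)
    · exact .inr ⟨(hh.mem_of_lt _ _ hab).1, rfl⟩
    · exact absurd (hh.mem_of_lt _ _ hbc).1 ho
    · exact absurd hb ho
  · simp only [hmem, hlt, reduceCtorEq, false_or]
    rintro k z l (hr | hr)
    · cases hr
      refine ⟨hjc, ?_⟩
      rintro a (rfl | ha) hat
      · exact .inr ⟨hjc, rfl⟩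
      · exact .inl (hja a ha hat)
    · obtain ⟨hc, hall⟩ := hread k z l hr
      refine ⟨hc, ?_⟩
      rintro a (rfl | ha) hat
      · exact .inr ⟨hc, rfl⟩
      · exact .inl (hall a ha hat)
  · simp only [hmem, hlt, reduceCtorEq, false_or, and_false, or_false]
    rintro k z ver l (hr | hr) hw hc hne
    · cases hr
      exact absurd (congrArg some (hwrite _ _ _ hjw hw)) hne
    · obtain ⟨a, ha, h'⟩ := hfresh k z ver l hr hw hc hne
      exact ⟨a, .inr ha, h'⟩
  · simpa only [hmem, reduceCtorEq, false_or] using hwrite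

lemma CommittedBefore.latestBefore {i : Tid} {x : Obj} {j : Tid}
    (hj : h.CommittedBefore i x (some j))
    (hwrite : ∀ i j x, .write i x ∈ h.ops → .write j x ∈ h.ops → i = j) :
    h.LatestBefore i x (some j) := by
  refine ⟨hj, ?_⟩
  rintro (_ | k) hk
  · exact .inr (hj j rfl).1
  · exact .inl (congrArg some (hwrite _ _ _ (hk k rfl).1 (hj j rfl).1))

end History

/-! ### Histories of executions, and transactions run without conflicts -/

namespace System

variable {Pr : Type w} {Obj : Type u} {Tid : Type v} {S : System.{u, v, w, s, t} Pr Obj Tid}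
  {R : Obj → Set Pr} {F : List S.Event → History Obj Tid}

lemma IsRefinementMapping.mem_ops (hF : S.IsRefinementMapping R F) {ρ : List S.Event}
    {c : S.Config} (h : S.Run R ρ c) {o : Op Obj Tid} : o ∈ (F ρ).ops ↔ Completed c.trace o := by
  rw [(hF ρ c h).2.1, exists_spans_iff]

/-- An operation of a transaction that is absent from `τ₁` is requested after `τ₁`, hence after all
operations completed in `τ₁`. This is the only use of real-time order. -/
lemma IsRefinementMapping.lt_of_completed (hF : S.IsRefinementMapping R F) {ρ : List S.Event}
    {c : S.Config} (h : S.Run R ρ c) {τ₁ τ₂ : List (Obs Pr Obj Tid)} (hτ : c.trace = τ₁ ++ τ₂)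
    {o o' : Op Obj Tid} (ho : Completed τ₁ o) (ho' : Completed c.trace o')
    (hne : ∀ m ∈ τ₁, m.txn ≠ o'.txn) : (F ρ).lt o o' := by
  obtain ⟨a, b, hs, hb⟩ := ho.exists_spans τ₂
  obtain ⟨a', b', hs'⟩ := exists_spans_iff.2 ho'
  rw [← hτ] at hs
  refine (hF ρ c h).2.2 o o' a b a' b' hs hs' (hb.trans_le ?_)
  rw [hτ] at hs'
  exact hs'.le_of_forall_mem hne

/-- Since no other transaction has asked to write, there is no write conflict at all, and the reply
cannot be an abort. -/
lemma Run.exists_reply [Finite Pr] (hOFU : S.ObstructionFreeUpdates R F)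
    (hWFQ : S.WaitFreeQueries R) {ρ : List S.Event} {c : S.Config} (h : S.Run R ρ c) {p : Pr}
    {i : Tid} {q : Request Obj} (hl : Legal R c.trace p i q)
    (hcf : ∀ j, i ≠ j → ∀ p z, .req p j (.write z) ∉ c.trace) :
    ∃ υ c' τ, S.Run R (ρ ++ υ) c' ∧ c'.trace = c.trace ++ τ ∧
      (∀ p' i' q', .req p' i' q' ∈ τ ↔ p' = p ∧ i' = i ∧ q' = q) ∧
      (∃ r o, r ≠ .abort ∧ Completes i q r o ∧ Completed c'.trace o) ∧
      ¬ Aborted c'.trace i ∧ ∀ p q, ¬ Outstanding c'.trace i p q := by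
  have h₁ := h.snoc (.request _ _ _ _ hl)
  obtain ⟨υ, c', τ, h₂, hτ, hreq, hno, hab⟩ := h₁.exists_answer hOFU hWFQ i
  have hab := hab (by
    rintro j hij ⟨z, -, p', hp'⟩
    simp only [Config.submit, List.mem_append, hcf j hij, List.mem_singleton, false_or] at hp'
    cases hp'
    exact hij rfl)
  have hw := h₂.wellFormed
  have hno' := hno p q
  rw [hτ] at hw hno'
  obtain ⟨r, o, hc, ho, hm⟩ := hw.exists_completed outstanding_concat_req hno'
  rw [← hτ] at ho hm
  refine ⟨.request p i q :: υ, c', .req p i q :: τ, by simpa using h₂, ?_, ?_, ⟨r, o, ?_, hc, ho⟩,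
    hab, hno⟩
  · simp [hτ, Config.submit]
  · simp [hreq]
  · rintro rfl
    exact hab ⟨_, hm⟩

/-- A transaction that reads and writes `z` and then terminates, alone among the updates. -/
lemma Run.exists_update [Finite Pr] (hOFU : S.ObstructionFreeUpdates R F)
    (hWFQ : S.WaitFreeQueries R) {ρ : List S.Event} {c : S.Config} (h : S.Run R ρ c) {p : Pr}
    {i : Tid} {z : Obj} (hp : p ∈ R z) (hi : ∀ m ∈ c.trace, m.txn ≠ i)
    (hcf : ∀ j p z, .req p j (.write z) ∉ c.trace) :
    ∃ υ c' τ, S.Run R (ρ ++ υ) c' ∧ c'.trace = c.trace ++ τ ∧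
      (∀ p' i' q', .req p' i' q' ∈ τ →
        p' = p ∧ i' = i ∧ (q' = .read z ∨ q' = .write z ∨ q' = .terminate)) ∧
      Completed c'.trace (.write i z) ∧ Completed c'.trace (.commit i) := by
  have hi' : ∀ p q, .req p i q ∉ c.trace := fun p q hm => hi _ hm rfl
  obtain ⟨υ₁, c₁, τ₁, h₁, ht₁, hr₁, -, ha₁, hn₁⟩ :=
    h.exists_reply hOFU hWFQ (legal_read_of_forall_txn_ne hi hp) fun j _ p z => hcf j p z
  have hl₁ : Legal R c₁.trace p i (.write z) := by
    refine ⟨h₁.wellFormed.not_terminated ha₁ ?_, hn₁, ?_, ?_, ?_⟩ <;> simp [ht₁, hr₁, hi']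
  obtain ⟨υ₂, c₂, τ₂, h₂, ht₂, hr₂, ⟨r, o, hne, hc, ho⟩, ha₂, hn₂⟩ :=
    h₁.exists_reply hOFU hWFQ hl₁ fun j hij p z => by simp [ht₁, hr₁, hcf]
  have hl₂ : Legal R c₂.trace p i .terminate := by
    refine ⟨h₂.wellFormed.not_terminated ha₂ ?_, hn₂, ?_, .read z, ?_⟩ <;>
      simp [ht₁, hr₁, ht₂, hr₂, hi']
    tauto
  obtain ⟨υ₃, c₃, τ₃, h₃, ht₃, hr₃, ⟨r', o', hne', hc', ho'⟩, -⟩ :=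
    h₂.exists_reply hOFU hWFQ hl₂ fun j hij p z => by simp [ht₁, hr₁, ht₂, hr₂, hcf, hij.symm]
  refine ⟨υ₁ ++ υ₂ ++ υ₃, c₃, τ₁ ++ τ₂ ++ τ₃, by simpa using h₃, by simp [ht₁, ht₂, ht₃],
    ?_, ?_, ?_⟩
  · intro p' i' q'
    simp only [List.mem_append, hr₁, hr₂, hr₃]
    tauto
  · cases hc with
    | write =>
      rw [ht₃]
      exact ho.append
    | abort => exact absurd rfl hne
  · cases hc' with
    | commit => exact ho'
    | abort => exact absurd rfl hne'

/-- A query may read the only version of `x` that is committed before its first operation. -/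
lemma Run.exists_fresh_read (hF : S.IsRefinementMapping R F) (hSI : S.NonTrivialSI R F)
    {ρ : List S.Event} {c : S.Config} (h : S.Run R ρ c) {p : Pr} {i j : Tid} {x : Obj}
    (hl : Legal R c.trace p i (.read x)) (hj : (F ρ).CommittedBefore i x (some j))
    (hi : ∀ p z, .req p i (.write z) ∉ c.trace)
    (hread : ∀ i x j, .read i x (some j) ∈ (F ρ).ops →
      .commit j ∈ (F ρ).ops ∧ ∀ a ∈ (F ρ).ops, a.txn = i → (F ρ).lt (.commit j) a)
    (hfresh : ∀ i x ver k, .read i x ver ∈ (F ρ).ops → .write k x ∈ (F ρ).ops →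
      .commit k ∈ (F ρ).ops → ver ≠ some k →
      ∃ a ∈ (F ρ).ops, a.txn = i ∧ (a = .commit k ∨ (F ρ).lt a (.commit k)))
    (hwrite : ∀ p p' i j x, .req p i (.write x) ∈ c.trace → .req p' j (.write x) ∈ c.trace →
      i = j) :
    ∃ υ c' τ, S.Run R (ρ ++ υ) c' ∧ c'.trace = c.trace ++ τ ∧
      (∀ p' i' q', .req p' i' q' ∈ τ → p' = p ∧ i' = i ∧ q' = .read x) ∧
      Completed c'.trace (.read i x (some j)) := by
  have hh := (hF ρ c h).1
  have hwrite' : ∀ i j x, .write i x ∈ (F ρ).ops → .write j x ∈ (F ρ).ops → i = j := by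
    intro i j x hwi hwj
    obtain ⟨p, hp⟩ := ((hF.mem_ops h).1 hwi).req_write
    obtain ⟨p', hp'⟩ := ((hF.mem_ops h).1 hwj).req_write
    exact hwrite _ _ _ _ _ hp hp'
  have ho : .read i x (some j) ∉ (F ρ).ops := by
    intro hr
    obtain ⟨p', hp'⟩ := ((hF.mem_ops h).1 hr).req_read
    obtain rfl := hl.2.2.1 _ _ hp'
    exact hl.2.2.2.1 hp'
  obtain ⟨υ, c', hno, h', ver, hver, hlt⟩ := hSI ρ c h i p x (some j) hl (hj.latestBefore hwrite')
    (hh.inSI_snoc_read ho hj hread hfresh hwrite')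
    (by
      rintro k - ⟨z, ⟨p', hp'⟩, -⟩
      exact hi _ _ hp')
  obtain ⟨τ, hτ, hreq⟩ := h.exists_trace h'
  have hreq' : ∀ p' i' q', .req p' i' q' ∈ τ → p' = p ∧ i' = i ∧ q' = .read x := by
    intro p' i' q' hm
    rcases List.mem_cons.1 ((hreq _ _ _).1 hm) with he | he
    · cases he
      exact ⟨rfl, rfl, rfl⟩
    · exact absurd he (hno _ _ _)
  refine ⟨_, c', τ, h', hτ, hreq', ?_⟩
  -- Non-triviality allows a later version, but `j` is the only transaction that ever asked to write
  -- `x`, and the extension adds no write request.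
  rcases hlt with rfl | hlt
  · exact (hF.mem_ops h').1 hver
  · exfalso
    rcases ver with _ | k
    · exact hlt
    · have hlt' : (F (ρ ++ .request p i (.read x) :: υ)).lt (.write j x) (.write k x) := hlt
      have hmem := (hF _ _ h').1.mem_of_lt _ _ hlt'
      obtain ⟨p₁, h₁⟩ := ((hF.mem_ops h').1 hmem.1).req_write
      obtain ⟨p₂, h₂⟩ := ((hF.mem_ops h').1 hmem.2).req_write
      have key : ∀ p k, .req p k (.write x) ∈ c'.trace → .req p k (.write x) ∈ c.trace := by
        intro p k hm
        rw [hτ] at hm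
        refine (List.mem_append.1 hm).resolve_right fun hm => ?_
        cases (hreq' _ _ _ hm).2.2
      obtain rfl := hwrite _ _ _ _ _ (key _ _ h₁) (key _ _ h₂)
      exact (hF _ _ h').1.irrefl _ hlt'

/-- A system all of whose steps are made at replicas of objects accessed before. -/
def Local (S : System.{u, v, w, s, t} Pr Obj Tid) (R : Obj → Set Pr) : Prop :=
  ∀ ρ c, S.Run R ρ c → ∀ p i r, .step p i r ∈ c.trace → ∃ x ∈ accessed c.trace i, p ∈ R x

lemma Run.exists_req_of_mem (hloc : S.Local R) {ρ : List S.Event} {c : S.Config}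
    (h : S.Run R ρ c) {m : Obs Pr Obj Tid} (hm : m ∈ c.trace) :
    ∃ p q, .req p m.txn q ∈ c.trace := by
  cases m with
  | req p i q => exact ⟨p, q, hm⟩
  | step p i r =>
    obtain ⟨x, ⟨p', h₁ | h₁⟩, -⟩ := hloc _ _ h p i r hm
    · exact ⟨p', _, h₁⟩
    · exact ⟨p', _, h₁⟩

/-- Locality turns control of the clients into control of the processes: if only `z` is accessed, no
process outside `R z` takes part. -/
lemma Run.proc_mem_replicas (hloc : S.Local R) {ρ : List S.Event} {c : S.Config}
    (h : S.Run R ρ c) {z : Obj} (hz : ∀ p i q, .req p i q ∈ c.trace →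
      p ∈ R z ∧ (q = .read z ∨ q = .write z ∨ q = .terminate)) :
    ∀ m ∈ c.trace, m.proc ∈ R z := by
  intro m hm
  cases m with
  | req p i q => exact (hz _ _ _ hm).1
  | step p i r =>
    obtain ⟨x, ⟨p', h₁ | h₁⟩, hp⟩ := hloc _ _ h p i r hm
    · obtain rfl : x = z := by simpa using (hz _ _ _ h₁).2
      exact hp
    · obtain rfl : x = z := by simpa using (hz _ _ _ h₁).2
      exact hp

end System

/-! ### The execution at the replicas of a single object -/

namespace System

variable {Pr : Type w} {Obj : Type u} {Tid : Type v} {S : System.{u, v, w, s, t} Pr Obj Tid}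
  {R : Obj → Set Pr} {F : List S.Event → History Obj Tid}

/-- A query `a` reads `x` and stays idle, then transaction `k` updates `x`, then a query `b` reads
the version of `x` written by `k`. -/
lemma exists_read_update_read [Finite Pr] (hF : S.IsRefinementMapping R F)
    (hOFU : S.ObstructionFreeUpdates R F) (hWFQ : S.WaitFreeQueries R)
    (hSI : S.NonTrivialSI R F) (hloc : S.Local R) {p : Pr} {x : Obj} (hp : p ∈ R x)
    {a b k : Tid} (hab : a ≠ b) (hak : a ≠ k) (hbk : b ≠ k) :
    ∃ ρ c τ₁ τ₂ τ₃, S.Run R ρ c ∧ c.trace = τ₁ ++ τ₂ ++ τ₃ ∧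
      (∀ p' i q, .req p' i q ∈ c.trace → p' = p ∧
        ((i = a ∨ i = b) ∧ q = .read x ∨
          i = k ∧ (q = .read x ∨ q = .write x ∨ q = .terminate))) ∧
      (∀ m ∈ τ₁, m.txn = a) ∧ (∀ m ∈ τ₁ ++ τ₂, m.txn ≠ b) ∧
      (∃ ver, Completed τ₁ (.read a x ver)) ∧ Completed c.trace (.write k x) ∧
      Completed (τ₁ ++ τ₂) (.commit k) ∧ Completed c.trace (.read b x (some k)) ∧
      Idle c.trace a := by
  obtain ⟨ρ₁, c₁, τ₁, h₁, ht₁, hr₁, ⟨r, o, hne, hc, ho⟩, ha₁, hn₁⟩ :=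
    (Run.nil (S := S) (R := R)).exists_reply hOFU hWFQ (p := p) (i := a) (q := .read x)
      (legal_read_of_forall_txn_ne (by simp [initial]) hp) (by simp [initial])
  obtain rfl : c₁.trace = τ₁ := ht₁
  have htxn₁ : ∀ m ∈ c₁.trace, m.txn = a := by
    intro m hm
    obtain ⟨p', q, hq⟩ := h₁.exists_req_of_mem hloc hm
    exact ((hr₁ _ _ _).1 hq).2.1
  have hidle₁ : Idle c₁.trace a :=
    ⟨h₁.wellFormed.not_terminated ha₁ (by simp [hr₁]), hn₁⟩
  obtain ⟨ver, rfl⟩ : ∃ ver, o = .read a x ver := by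
    cases hc with
    | read _ ver => exact ⟨ver, rfl⟩
    | abort => exact absurd rfl hne
  obtain ⟨ρ₂, c₂, τ₂, h₂, ht₂, hr₂, hw₂, hc₂⟩ := h₁.exists_update hOFU hWFQ (i := k) hp
    (fun m hm => by rw [htxn₁ m hm]; exact hak) (by simp [hr₁])
  have hreq₂ : ∀ p' i q, .req p' i q ∈ c₂.trace → p' = p ∧
      (i = a ∧ q = .read x ∨ i = k ∧ (q = .read x ∨ q = .write x ∨ q = .terminate)) := by
    intro p' i q hm
    rw [ht₂, List.mem_append, hr₁] at hm
    rcases hm with hm | hm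
    · tauto
    · have := hr₂ _ _ _ hm
      tauto
  have htxn₂ : ∀ m ∈ c₂.trace, m.txn ≠ b := by
    intro m hm
    obtain ⟨p', q, hq⟩ := h₂.exists_req_of_mem hloc hm
    rcases (hreq₂ _ _ _ hq).2 with ⟨h, -⟩ | ⟨h, -⟩ <;> rw [h]
    · exact hab
    · exact hbk.symm
  have hidle₂ : Idle c₂.trace a := by
    have hw := h₂.wellFormed
    rw [ht₂] at hw ⊢
    exact hidle₁.append hw fun p' q hm => hak (hr₂ _ _ _ hm).2.1
  have hh := (hF _ _ h₂).1
  have hread₂ : ∀ i z v, .read i z v ∈ (F ([] ++ ρ₁ ++ ρ₂)).ops → z = x ∧ (i = a ∨ i = k) := by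
    intro i z v hv
    obtain ⟨p', hp'⟩ := ((hF.mem_ops h₂).1 hv).req_read
    have := (hreq₂ _ _ _ hp').2
    simp only [Request.read.injEq, reduceCtorEq, or_false] at this
    tauto
  have hwreq₂ : ∀ p' i z, .req p' i (.write z) ∈ c₂.trace → z = x ∧ i = k := by
    intro p' i z hp'
    have := (hreq₂ _ _ _ hp').2
    simp only [Request.write.injEq, reduceCtorEq, or_false, and_false, false_or] at this
    tauto
  have hwrite₂ : ∀ i z, .write i z ∈ (F ([] ++ ρ₁ ++ ρ₂)).ops → z = x ∧ i = k := by
    intro i z hv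
    obtain ⟨p', hp'⟩ := ((hF.mem_ops h₂).1 hv).req_write
    exact hwreq₂ _ _ _ hp'
  have hra : .read a x ver ∈ (F ([] ++ ρ₁ ++ ρ₂)).ops := by
    rw [hF.mem_ops h₂, ht₂]
    exact ho.append
  obtain ⟨ρ₃, c₃, τ₃, h₃, ht₃, hr₃, hb₃⟩ := h₂.exists_fresh_read hF hSI (p := p) (i := b) (j := k)
    (legal_read_of_forall_txn_ne htxn₂ hp)
    (by
      rintro j ⟨⟩
      refine ⟨(hF.mem_ops h₂).2 hw₂, (hF.mem_ops h₂).2 hc₂, fun o ho hob => ?_⟩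
      obtain ⟨p', q, r, hm, -⟩ := ((hF.mem_ops h₂).1 ho).exists_req
      exact absurd hob (htxn₂ _ hm))
    (fun p' z hm => hbk (hwreq₂ _ _ _ hm).2)
    (by
      intro i z j hv
      -- No written version has been read yet: the read of `a` was complete before `k` began, and
      -- `k` cannot read its own version.
      exfalso
      have hlt := hh.reads_from _ _ _ hv
      obtain ⟨rfl, rfl⟩ := hwrite₂ _ _ (hh.mem_of_lt _ _ hlt).1
      rcases (hread₂ _ _ _ hv).2 with rfl | rfl
      · obtain rfl := hh.read_once _ _ _ _ hv hra
        exact hh.asymm hlt (hF.lt_of_completed h₂ ht₂ ho hw₂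
          fun m hm => by rw [htxn₁ m hm]; exact hak)
      · exact hh.not_read_self _ _ hv)
    (by
      intro i z v j hv hw hc hne
      -- The read of `a` lies before `c_k`; for `k` itself its own commit serves as the required
      -- operation.
      obtain ⟨rfl, rfl⟩ := hwrite₂ _ _ hw
      rcases (hread₂ _ _ _ hv).2 with rfl | rfl
      · exact ⟨_, hra, rfl, .inr (hF.lt_of_completed h₂ ht₂ ho hc₂
          fun m hm => by rw [htxn₁ m hm]; exact hak)⟩
      · exact ⟨_, hc, rfl, .inl rfl⟩)
    (fun p p' i j z hi hj => (hwreq₂ _ _ _ hi).2.trans (hwreq₂ _ _ _ hj).2.symm)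
  refine ⟨_, c₃, c₁.trace, τ₂, τ₃, h₃, by rw [ht₃, ht₂], ?_, htxn₁, by rwa [ht₂] at htxn₂,
    ⟨ver, ho⟩, ?_, by rwa [ht₂] at hc₂, hb₃, ?_⟩
  · intro p' i q hm
    rw [ht₃, List.mem_append] at hm
    rcases hm with hm | hm
    · have := hreq₂ _ _ _ hm
      tauto
    · have := hr₃ _ _ _ hm
      tauto
  · rw [ht₃]
    exact hw₂.append
  · have hw := h₃.wellFormed
    rw [ht₃] at hw ⊢
    exact hidle₂.append hw fun p' q hm => hab (hr₃ _ _ _ hm).2.1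

end System

end PartialReplication

/-! ### The cycle of snapshots -/

open PartialReplication
theorem mainTheorem3 {Pr Obj Tid : Type*} [Finite Pr] [Infinite Tid]
    (R : Obj → Set Pr) (x y : Obj) (hx : (R x).Nonempty) (hy : (R y).Nonempty)
    (hxy : Disjoint (R x) (R y))
    (S : System Pr Obj Tid) (F : List S.Event → History Obj Tid)
    (hF : S.IsRefinementMapping R F)
    (hGPR : S.GPR R)
    (hOFU : S.ObstructionFreeUpdates R F)
    (hWFQ : S.WaitFreeQueries R)
    (hSI : S.NonTrivialSI R F) :
    ¬ S.Implements R F History.MON := by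
  intro hMON
  have hloc : S.Local R := fun ρ c h p i r hs =>
    h.step_mem_replicas hGPR hOFU hWFQ hx hy hxy hs
  obtain ⟨a, b, k, l, hab, hak, hal, hbk, hbl, hkl⟩ :
      ∃ a b k l : Tid, a ≠ b ∧ a ≠ k ∧ a ≠ l ∧ b ≠ k ∧ b ≠ l ∧ k ≠ l := by
    have e := Infinite.natEmbedding Tid
    refine ⟨e 0, e 1, e 2, e 3, ?_, ?_, ?_, ?_, ?_, ?_⟩ <;> simp
  obtain ⟨px, hpx⟩ := id hx
  obtain ⟨py, hpy⟩ := id hy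
  have hxy' : x ≠ y := fun he => Set.disjoint_left.1 hxy hpx (he ▸ hpx)
  -- transaction `l` updates `y`
  obtain ⟨ρ₁, c₁, τ, h₁, ht, hr₁, hw₁, hc₁⟩ :=
    (System.Run.nil (S := S) (R := R)).exists_update hOFU hWFQ (i := l) hpy
      (by simp [System.initial]) (by simp [System.initial])
  obtain rfl : c₁.trace = τ := ht
  rw [List.nil_append] at h₁
  obtain ⟨ρ₂, c₂, τ₁, τ₂, τ₃, h₂, ht₂, hr₂, htxn₁, htxn₂, ⟨ver, ha⟩, hw₂, hc₂, hb, hidle⟩ :=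
    System.exists_read_update_read hF hOFU hWFQ hSI hloc hpx hab hak hbk
  have hproc₁ : ∀ m ∈ c₁.trace, m.proc ∈ R y := h₁.proc_mem_replicas hloc fun p i q hm =>
    ⟨(hr₁ _ _ _ hm).1 ▸ hpy, (hr₁ _ _ _ hm).2.2⟩
  have hproc₂ : ∀ m ∈ c₂.trace, m.proc ∈ R x := h₂.proc_mem_replicas hloc fun p i q hm =>
    ⟨(hr₂ _ _ _ hm).1 ▸ hpx, by have := (hr₂ _ _ _ hm).2; tauto⟩
  have hl₁ : ∀ m ∈ c₁.trace, m.txn = l := by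
    intro m hm
    obtain ⟨p, q, hq⟩ := h₁.exists_req_of_mem hloc hm
    exact (hr₁ _ _ _ hq).2.1
  have hl₂ : ∀ m ∈ c₂.trace, m.txn ≠ l := by
    intro m hm
    obtain ⟨p, q, hq⟩ := h₂.exists_req_of_mem hloc hm
    rcases (hr₂ _ _ _ hq).2 with ⟨h | h, -⟩ | ⟨h, -⟩ <;> rw [h] <;> assumption
  have htxn : ∀ m ∈ c₁.trace, ∀ m' ∈ c₂.trace, m.txn ≠ m'.txn := fun m hm m' hm' he =>
    hl₂ m' hm' (he ▸ hl₁ m hm)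
  have h₁₂ := h₁.append_run h₂ (fun m hm hm' => Set.disjoint_left.1 hxy hm' (hproc₁ m hm))
    hproc₂ htxn
  have h₂₁ := h₂.append_run h₁ (fun m hm => Set.disjoint_left.1 hxy (hproc₂ m hm)) hproc₁
    fun m hm m' hm' => (htxn m' hm' m hm).symm
  -- when `l` runs first, the query `a` may read the version of `y` written by `l`
  obtain ⟨υ, c', τ', h', ht', -, hay⟩ : ∃ υ c' τ', S.Run R (ρ₁ ++ ρ₂ ++ υ) c' ∧
      c'.trace = (c₁.trace ++ c₂.trace) ++ τ' ∧
      (∀ p' i' q', .req p' i' q' ∈ τ' → p' = px ∧ i' = a ∧ q' = .read y) ∧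
      Completed c'.trace (.read a y (some l)) := by
    have hh := (hF _ _ h₁₂).1
    have hmem : ∀ {o}, o ∈ (F (ρ₁ ++ ρ₂)).ops ↔ Completed (c₁.trace ++ c₂.trace) o :=
      hF.mem_ops h₁₂
    have hreq : ∀ p i q, .req p i q ∈ c₁.trace ++ c₂.trace →
        (i = l ∧ (q = .read y ∨ q = .write y ∨ q = .terminate)) ∨ p = px ∧
        ((i = a ∨ i = b) ∧ q = .read x ∨
          i = k ∧ (q = .read x ∨ q = .write x ∨ q = .terminate)) := by
      intro p i q hm
      rcases List.mem_append.1 hm with hm | hm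
      · exact .inl (hr₁ _ _ _ hm).2
      · exact .inr (hr₂ _ _ _ hm)
    have hwreq : ∀ p i z, .req p i (.write z) ∈ c₁.trace ++ c₂.trace →
        (z = x ∧ i = k) ∨ (z = y ∧ i = l) := by
      intro p i z hm
      have := hreq _ _ _ hm
      simp only [Request.write.injEq, reduceCtorEq, or_false, and_false, false_or] at this
      tauto
    have hread : ∀ i z v, .read i z v ∈ (F (ρ₁ ++ ρ₂)).ops →
        (z = x ∧ (i = a ∨ i = b ∨ i = k)) ∨ (z = y ∧ i = l) := by
      intro i z v hv
      obtain ⟨p, hp⟩ := (hmem.1 hv).req_read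
      have := hreq _ _ _ hp
      simp only [Request.read.injEq, reduceCtorEq, or_false] at this
      tauto
    have hwrite : ∀ i z, .write i z ∈ (F (ρ₁ ++ ρ₂)).ops →
        (z = x ∧ i = k) ∨ (z = y ∧ i = l) := by
      intro i z hv
      obtain ⟨p, hp⟩ := (hmem.1 hv).req_write
      exact hwreq _ _ _ hp
    -- Two cuts of the trace: the first lies before `k` begins and after the read of `a`, the second
    -- before `b` begins and after `k` commits.
    have htr : c₁.trace ++ c₂.trace = (c₁.trace ++ τ₁) ++ (τ₂ ++ τ₃) := by simp [ht₂]
    have htr' : c₁.trace ++ c₂.trace = (c₁.trace ++ (τ₁ ++ τ₂)) ++ τ₃ := by simp [ht₂]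
    have hk : ∀ m ∈ c₁.trace ++ τ₁, m.txn ≠ k := by
      intro m hm
      rcases List.mem_append.1 hm with hm | hm
      · rw [hl₁ m hm]
        exact hkl.symm
      · rw [htxn₁ m hm]
        exact hak
    have hbt : ∀ m ∈ c₁.trace ++ (τ₁ ++ τ₂), m.txn ≠ b := by
      intro m hm
      rcases List.mem_append.1 hm with hm | hm
      · rw [hl₁ m hm]
        exact hbl.symm
      · exact htxn₂ m hm
    have hcl : Completed (c₁.trace ++ c₂.trace) (.commit l) := hc₁.append
    have hck : Completed (c₁.trace ++ c₂.trace) (.commit k) := by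
      rw [htr']
      exact (hc₂.append_left _).append
    have hwk : Completed (c₁.trace ++ c₂.trace) (.write k x) := hw₂.append_left _
    have hra : .read a x ver ∈ (F (ρ₁ ++ ρ₂)).ops := by
      rw [hmem, htr]
      exact (ha.append_left _).append
    have hrb : .read b x (some k) ∈ (F (ρ₁ ++ ρ₂)).ops := hmem.2 (hb.append_left _)
    have hreqa : .req px a (.read x) ∈ c₁.trace ++ c₂.trace := by
      obtain ⟨p, hp⟩ := (hmem.1 hra).req_read
      have := hreq _ _ _ hp
      simp only [Request.read.injEq, hal, hak, false_and, false_or, or_false] at this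
      rwa [this.1] at hp
    have hidle' : Idle (c₁.trace ++ c₂.trace) a := by
      have hpr : proj a (c₁.trace ++ c₂.trace) = proj a c₂.trace := by
        rw [proj_append, proj_eq_nil, List.nil_append]
        intro m hm
        rw [hl₁ m hm]
        exact hal.symm
      refine ⟨fun hta => hidle.1 ?_, fun p q hoa => hidle.2 p q ((outstanding_congr hpr).1 hoa)⟩
      rwa [← terminated_proj, hpr, terminated_proj] at hta
    refine h₁₂.exists_fresh_read hF hSI ⟨hidle'.1, hidle'.2, ?_, ?_, ?_⟩ ?_ ?_ ?_ ?_ ?_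
    · intro p q hm
      exact h₁₂.wellFormed.req_proc_unique hm hreqa
    · intro hm
      have := hreq _ _ _ hm
      simp only [Request.read.injEq, hal, hak, hxy'.symm, false_and, false_or, and_false] at this
    · exact fun hno => absurd hreqa (hno _)
    · rintro j ⟨⟩
      refine ⟨hmem.2 hw₁.append, hmem.2 hcl, fun o ho hoa => ?_⟩
      refine hF.lt_of_completed h₁₂ rfl hc₁ (hmem.1 ho) fun m hm => ?_
      rw [hl₁ m hm, hoa]
      exact hal.symm
    · intro p z hm
      rcases hwreq _ _ _ hm with ⟨-, he⟩ | ⟨-, he⟩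
      · exact hak he
      · exact hal he
    · intro i z j hv
      have hlt := hh.reads_from _ _ _ hv
      -- The only read of a written version so far is that of `x_k` by `b`, which began after `c_k`.
      rcases hwrite _ _ (hh.mem_of_lt _ _ hlt).1 with ⟨rfl, rfl⟩ | ⟨rfl, rfl⟩
      · rcases hread _ _ _ hv with ⟨-, rfl | rfl | rfl⟩ | ⟨he, -⟩
        · obtain rfl := hh.read_once _ _ _ _ hv hra
          exact absurd (hF.lt_of_completed h₁₂ htr (ha.append_left _) hwk hk) (hh.asymm hlt)
        · refine ⟨hmem.2 hck, fun o ho hob => ?_⟩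
          exact hF.lt_of_completed h₁₂ htr' (hc₂.append_left _) (hmem.1 ho) (by rwa [hob])
        · exact absurd hv (hh.not_read_self _ _)
        · exact absurd he hxy'
      · rcases hread _ _ _ hv with ⟨he, -⟩ | ⟨-, rfl⟩
        · exact absurd he hxy'.symm
        · exact absurd hv (hh.not_read_self _ _)
    · intro i z v j hv hw hc hne
      rcases hwrite _ _ hw with ⟨rfl, rfl⟩ | ⟨rfl, rfl⟩
      · rcases hread _ _ _ hv with ⟨-, rfl | rfl | rfl⟩ | ⟨he, -⟩
        · exact ⟨_, hra, rfl, .inr (hF.lt_of_completed h₁₂ htr (ha.append_left _) hck hk)⟩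
        · exact absurd (hh.read_once _ _ _ _ hv hrb) hne
        · exact ⟨_, hc, rfl, .inl rfl⟩
        · exact absurd he hxy'
      · rcases hread _ _ _ hv with ⟨he, -⟩ | ⟨-, rfl⟩
        · exact absurd he hxy'.symm
        · exact ⟨_, hc, rfl, .inl rfl⟩
    · intro p p' i j z hi hj
      rcases hwreq _ _ _ hi with ⟨rfl, rfl⟩ | ⟨rfl, rfl⟩ <;>
        rcases hwreq _ _ _ hj with ⟨he, rfl⟩ | ⟨he, rfl⟩
      · rfl
      · exact absurd he hxy'
      · exact absurd he hxy'.symm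
      · rfl
  -- the same continuation is possible when `l` runs last
  obtain ⟨d, hd, -, -, hproj⟩ := h₁₂.transfer h' h₂₁
    (by
      -- A process that replicates neither object is in its initial state in both orders.
      funext p
      by_cases hpx : p ∈ R x
      · have hpy : p ∉ R y := Set.disjoint_left.1 hxy hpx
        simp [hpx, hpy]
      · by_cases hpy : p ∈ R y
        · simp [hpx, hpy]
        · simp only [hpx, hpy, if_false]
          rw [h₁.state_eq_init (p := p) fun m hm he => hpy (he ▸ hproc₁ m hm),
            h₂.state_eq_init (p := p) fun m hm he => hpx (he ▸ hproc₂ m hm)])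
    (add_comm _ _)
    (by
      intro i
      simp only [proj_append]
      by_cases hi : i = l
      · rw [proj_eq_nil (τ := c₂.trace) (by rwa [hi])]
        simp
      · rw [proj_eq_nil (τ := c₁.trace) fun m hm => by rw [hl₁ m hm]; exact Ne.symm hi]
        simp)
  obtain ⟨τ'', hτ, -⟩ := h₂₁.exists_trace hd
  have hay' : Completed d.trace (.read a y (some l)) := (completed_congr (hproj _)).1 hay
  have hτ₁ : d.trace = τ₁ ++ (τ₂ ++ τ₃ ++ c₁.trace ++ τ'') := by simp [hτ, ht₂]
  have hτ₂ : d.trace = c₂.trace ++ (c₁.trace ++ τ'') := by simp [hτ]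
  have hck : Completed d.trace (.commit k) := by
    rw [hτ, ht₂]
    exact hc₂.append.append.append
  have hcl : Completed d.trace (.commit l) := by
    rw [hτ]
    exact (hc₁.append_left _).append
  have hra : Completed d.trace (.read a x ver) := hτ₁ ▸ ha.append
  have hrb : Completed d.trace (.read b x (some k)) := hτ₂ ▸ hb.append
  -- Here `l` starts only after `b` has read `x_k`, although `a`, which started before `k`, reads
  -- `y_l`. Both edges of the cycle are of the kind "read before commit".
  refine hMON _ _ hd a (.tail (.single (b := b) ⟨hab, x, ver, x, k, (hF.mem_ops hd).2 hra,
    (hF.mem_ops hd).2 hrb, .inl ?_⟩) ⟨hab.symm, x, some k, y, l, (hF.mem_ops hd).2 hrb,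
    (hF.mem_ops hd).2 hay', .inl ?_⟩)
  · exact hF.lt_of_completed hd hτ₁ ha hck fun m hm => by rw [htxn₁ m hm]; exact hak
  · exact hF.lt_of_completed hd hτ₂ hb hcl hl₂
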